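/- **The game.** Let $G$ be a graph and let $r,m,s$ be non-negative integers. In the game of Revolutionaries and Spies, first each of $r$ revolutionaries chooses a vertex of $G$, and then each of $s$ spies chooses a vertex (several players may share a vertex). In each subsequent round every revolutionary stays where he is or moves to an adjacent vertex, and then every spy does the same; all positions are known to both sides. The revolutionaries win if at the end of some round (the initial placement included) there is an unguarded meeting, i.e. a vertex occupied by at least $m$ revolutionaries and by no spy; the spies win if they have a strategy that prevents this forever. The spy number $\sigma(G,r,m)$ is the least number $s$ of spies that win. Let $G(n,p)$ denote the random graph on $n$ labelled vertices in which each of the $\binom n2$ pairs is an edge independently with probability $p$. All asymptotics are as $n\to\infty$; $f\ll g$ means $f=o(g)$, and $\log$ is the natural logarithm. **Theorem 1.5.** Let $\varepsilon>0$, let $r=r(n)$ and $m=m(n)$ be natural numbers with $1\le m\le r$ for all large $n$ and $r-m=O(1)$, and let $p=p(n)\in[0,1]$. Suppose that either * $\log^3 n\le pn$ for all large $n$ and $pn\ll\sqrt{n\log n}$, or * $\sqrt{n\log n}\ll pn$ and $pn<(1-\varepsilon)n$ for all large $n$. Then asymptotically almost surely $\sigma(G(n,p),r,m)=r-m+1$;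 that is, $$\lim_{n\to\infty}\mathbb P\bigl(\sigma(G(n,p),r,m)=r-m+1\bigr)=1 .$$ -/

import Mathlib

open Filter Topology Asymptotics

namespace RevSpies

/-- A legal simultaneous move of a team of `k` labelled tokens on the graph `G`: every token stays
where it is or moves to an adjacent vertex. -/
def LegalMove {V : Type*} (G : SimpleGraph V) {k : ℕ} (c c' : Fin k → V) : Prop :=
  ∀ i, c' i = c i ∨ G.Adj (c i) (c' i)

/-- With the revolutionaries at the positions `R` and the spies at the positions `S`, there is an
unguarded meeting: a vertex with at least `m` revolutionaries and no spy. -/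
def UnguardedMeeting {V : Type*} {r s : ℕ} (m : ℕ) (R : Fin r → V) (S : Fin s → V) : Prop :=
  ∃ v, m ≤ {i | R i = v}.ncard ∧ ∀ k, S k ≠ v

/-- The list `[ρ 0, ρ 1, …, ρ t]` of the first `t + 1` entries of the sequence `ρ`. -/
def history {α : Type*} (ρ : ℕ → α) (t : ℕ) : List α :=
  (List.range (t + 1)).map ρ

/-- The team of `s` spies wins against `r` revolutionaries trying to hold a meeting of size `m`
on `G`. A strategy `τ` of the spies answers the list of all the positions that the
revolutionaries have taken up to the present round (including the initial one) with the next
positions of the spies. Round `0` is the initial placement, first of the revolutionaries and then of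
the spies. The strategy has to be legal and has to prevent unguarded meetings at the end of
every round, whatever legal sequence `ρ` of positions the revolutionaries choose. -/
def SpiesWin {V : Type*} (G : SimpleGraph V) (r m s : ℕ) : Prop :=
  ∃ τ : List (Fin r → V) → (Fin s → V),
    ∀ ρ : ℕ → (Fin r → V), (∀ t, LegalMove G (ρ t) (ρ (t + 1))) →
      (∀ t, LegalMove G (τ (history ρ t)) (τ (history ρ (t + 1)))) ∧
      (∀ t, ¬ UnguardedMeeting m (ρ t) (τ (history ρ t)))

/-- The spy number `σ(G, r, m)`: the least number of spies that win. -/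
noncomputable def spyNumber {V : Type*} (G : SimpleGraph V) (r m : ℕ) : ℕ :=
  sInf {s | SpiesWin G r m s}

end RevSpies

/-! Upper bound: `r - m + 1` spies, each shadowing a revolutionary of his own, leave only `m - 1`
revolutionaries unshadowed, too few for a meeting.

Lower bound: the game is reduced to the graph property `Mergeable G C`. Two unguarded
revolutionaries can walk for equally many rounds to a common vertex that no spy can reach in that
time. Against a fixed strategy of `s ≤ C` spies with `r ≥ m + s`, an unguarded group is enlarged
repeatedly: among `s + 1` outsiders on distinct vertices one is unguarded, and he joins the group
(`not_spiesWin_of_mergeable`). Since `r - m` is bounded, one constant `C` serves for all `n`.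

Random graphs are mergeable by two-stage exposure. Explore the balls of radius `j` around `u`, `x`
and the opponents `S`; the pairs from the outer sphere to the unexplored vertices remain unexamined.
Given the exploration, each unexplored vertex independently has the same chance of joining the
frontiers of `u` and `x` while missing that of `S`. If the expected number of such vertices is at
least `(2C + 4) log n`, a union bound over `u`, `x`, `S` succeeds (`real_noMeeting_le`,
`real_exists_noMeeting_le`).

In the dense range `j = 0` suffices, with expectation about `n p² (1 - p)^C`. In the sparse range
expansion (`Expands.pow_le_card`) makes the part of a ball that the opponents cannot reach grow by a
factor `D ≈ pn` per step, and `j` is chosen with `D^(2j) < n log² n ≤ D^(2(j+1))`. With `α = p D^j /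
2` the expectation is at least of order `(1 - e^{-α})² e^{-8Cα} n` (`chance_bound`). The loss
`e^{-8Cα}` is dangerous only for `j = 1`, where `pn ≪ √(n log n)` controls it. The bound `log³ n ≤
pn` allows relative errors `η` of order `1 / log n`, small enough to survive `j` steps. -/

namespace RevSpies

/-! ### Balls and the meeting property. -/

open Classical in
/-- The closed neighbourhood of a set of vertices. -/
noncomputable def closedNbhd {V : Type*} [Fintype V] (G : SimpleGraph V) (A : Finset V) :
    Finset V :=
  Finset.univ.filter fun v => v ∈ A ∨ ∃ a ∈ A, G.Adj a v

/-- The closed ball of radius `t` around a set of vertices. -/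
noncomputable def ball {V : Type*} [Fintype V] (G : SimpleGraph V) (A : Finset V) : ℕ → Finset V
  | 0 => A
  | t + 1 => closedNbhd G (ball G A t)

/-- Two tokens avoiding at most `C` opponents can meet: there is a vertex within distance `t` of
both tokens and at distance more than `t` from all opponents. -/
def Mergeable {V : Type*} [Fintype V] (G : SimpleGraph V) (C : ℕ) : Prop :=
  ∀ u x : V, u ≠ x → ∀ S : Finset V, S.card ≤ C → u ∉ S → x ∉ S →
    ∃ t w, w ∈ ball G {u} t ∧ w ∈ ball G {x} t ∧ w ∉ ball G S t

section Balls

variable {V : Type*} [Fintype V] {G : SimpleGraph V}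

lemma mem_closedNbhd {A : Finset V} {v : V} :
    v ∈ closedNbhd G A ↔ v ∈ A ∨ ∃ a ∈ A, G.Adj a v := by
  simp [closedNbhd]

lemma subset_closedNbhd (A : Finset V) : A ⊆ closedNbhd G A := fun _ h => mem_closedNbhd.2 (.inl h)

lemma closedNbhd_mono {A B : Finset V} (h : A ⊆ B) : closedNbhd G A ⊆ closedNbhd G B := by
  intro v hv
  rw [mem_closedNbhd] at hv ⊢
  rcases hv with hv | ⟨a, ha, hav⟩
  · exact .inl (h hv)
  · exact .inr ⟨a, h ha, hav⟩

lemma ball_mono {A B : Finset V} (h : A ⊆ B) (t : ℕ) : ball G A t ⊆ ball G B t := by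
  induction t with
  | zero => exact h
  | succ t ih => exact closedNbhd_mono ih

lemma ball_subset_succ (A : Finset V) (t : ℕ) : ball G A t ⊆ ball G A (t + 1) :=
  subset_closedNbhd _

lemma ball_mono_right (A : Finset V) {s t : ℕ} (h : s ≤ t) : ball G A s ⊆ ball G A t := by
  induction h with
  | refl => exact subset_rfl
  | step _ ih => exact ih.trans (ball_subset_succ _ _)

lemma ball_add (A : Finset V) (s t : ℕ) : ball G A (s + t) = ball G (ball G A s) t := by
  induction t with
  | zero => rfl
  | succ t ih => rw [← add_assoc]; simp only [ball, ih]

lemma ball_closedNbhd (A : Finset V) (t : ℕ) : ball G (closedNbhd G A) t = ball G A (t + 1) := by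
  rw [add_comm, ball_add]; rfl

/-- A vertex of the ball is reached by a lazy walk. -/
lemma exists_walk_of_mem_ball {u w : V} {t : ℕ} (h : w ∈ ball G {u} t) :
    ∃ π : ℕ → V, π 0 = u ∧ π t = w ∧ ∀ i, π (i + 1) = π i ∨ G.Adj (π i) (π (i + 1)) := by
  induction t generalizing w with
  | zero =>
    have : w = u := by simpa [ball] using h
    exact ⟨fun _ => u, rfl, this.symm, fun _ => .inl rfl⟩
  | succ t ih =>
    obtain ⟨a, ha, haw⟩ : ∃ a ∈ ball G {u} t, w = a ∨ G.Adj a w := by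
      rcases mem_closedNbhd.1 h with h | ⟨a, ha, haw⟩
      · exact ⟨w, h, .inl rfl⟩
      · exact ⟨a, ha, .inr haw⟩
    obtain ⟨π, h0, ht, hπ⟩ := ih ha
    refine ⟨fun i => if i ≤ t then π i else w, by simp [h0], by simp, fun i => ?_⟩
    rcases lt_trichotomy i t with hi | rfl | hi
    · simpa [hi.le, Nat.succ_le_of_lt hi] using hπ i
    · simpa [ht] using haw
    · simp [hi.not_ge, (hi.trans (Nat.lt_succ_self i)).not_ge]

lemma mem_ball_of_walk {A : Finset V} {σ : ℕ → V} (h0 : σ 0 ∈ A)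
    (hσ : ∀ i, σ (i + 1) = σ i ∨ G.Adj (σ i) (σ (i + 1))) (t : ℕ) : σ t ∈ ball G A t := by
  induction t with
  | zero => exact h0
  | succ t ih =>
    rcases hσ t with h | h
    · rw [h]; exact ball_subset_succ _ _ ih
    · exact mem_closedNbhd.2 (.inr ⟨_, ih, h⟩)

/-- In a graph in which tokens can avoid `C` opponents all closed neighbourhoods are large. -/
lemma Mergeable.card_closedNbhd {C : ℕ} (h : Mergeable G C) (hV : C + 2 ≤ Fintype.card V) (v : V) :
    C + 1 ≤ (closedNbhd G {v}).card := by
  classical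
  by_contra! hlt
  obtain ⟨x, hx⟩ : ∃ x, x ∉ closedNbhd G {v} := by
    by_contra! hall
    have : closedNbhd G {v} = Finset.univ := Finset.eq_univ_iff_forall.2 hall
    rw [this, Finset.card_univ] at hlt
    omega
  have hv : v ∈ closedNbhd G {v} := subset_closedNbhd _ (by simp)
  have hvx : v ≠ x := fun e => hx (e ▸ hv)
  -- Opponents on all the neighbours of `v` enclose the token: after one step they cover whatever it
  -- can reach.
  set S := (closedNbhd G {v}).erase v with hS
  obtain ⟨t, w, hwv, hwx, hwS⟩ := h v x hvx S
    (by rw [hS, Finset.card_erase_of_mem hv]; omega) (by simp [hS])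
    (fun hxS => hx (Finset.mem_of_mem_erase hxS))
  rcases t with _ | t
  · simp only [ball, Finset.mem_singleton] at hwv hwx
    exact hvx (hwv.symm.trans hwx)
  -- Without neighbours there are no opponents; then `v` is isolated and the token from `x` cannot
  -- reach it.
  rcases S.eq_empty_or_nonempty with hSe | ⟨y, hy⟩
  · have hN : closedNbhd G {v} = {v} := by
      rw [← Finset.insert_erase hv, ← hS, hSe]; rfl
    have hball : ∀ k, ball G {v} k = {v} := by
      intro k
      induction k with
      | zero => rfl
      | succ k ih => simp only [ball, ih, hN]
    have hwv' : w = v := by simpa [hball] using hwv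
    obtain ⟨π, h0, ht, hπ⟩ := exists_walk_of_mem_ball hwx
    have hback : ∀ k, π k = v → π 0 = v := by
      intro k
      induction k with
      | zero => exact id
      | succ k ih =>
        intro hk
        apply ih
        rcases hπ k with e | e
        · rw [← e, hk]
        · have : π k ∈ closedNbhd G {v} :=
            mem_closedNbhd.2 (.inr ⟨v, by simp, by rw [hk] at e; exact e.symm⟩)
          simpa [hN] using this
    exact hvx (by rw [← hback (t + 1) (ht.trans hwv'), h0])
  · apply hwS
    have hsub : closedNbhd G {v} ⊆ closedNbhd G S := by
      intro z hz
      by_cases hzv : z = v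
      · have hy' := Finset.mem_of_mem_erase hy
        have hyv : y ≠ v := Finset.ne_of_mem_erase hy
        rcases mem_closedNbhd.1 hy' with h | ⟨a, ha, hay⟩
        · exact absurd (by simpa using h) hyv
        · rw [Finset.mem_singleton] at ha
          subst ha
          rw [hzv]
          exact mem_closedNbhd.2 (.inr ⟨y, hy, hay.symm⟩)
      · exact subset_closedNbhd _ (Finset.mem_erase.2 ⟨hzv, hz⟩)
    rw [← ball_closedNbhd] at hwv ⊢
    exact ball_mono hsub t hwv

end Balls

/-! ### The game on a fixed graph. -/

lemma getLast?_history {α : Type*} (ρ : ℕ → α) (t : ℕ) : (history ρ t).getLast? = some (ρ t) := by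
  simp [history, List.range_succ]

/-- Spies who shadow `r - m + 1` distinct revolutionaries win. -/
theorem spiesWin_of_shadowing {V : Type*} [Nonempty V] (G : SimpleGraph V) {r m : ℕ} (h1 : 1 ≤ m)
    (hmr : m ≤ r) : SpiesWin G r m (r - m + 1) := by
  classical
  have hle : r - m + 1 ≤ r := by omega
  -- Histories are never empty, so the default position is never played.
  refine ⟨fun l k => (l.getLast?.getD fun _ => Classical.arbitrary V) (Fin.castLE hle k),
    fun ρ hρ => ⟨fun t k => ?_, fun t => ?_⟩⟩
  · simpa only [getLast?_history, Option.getD_some] using hρ t (Fin.castLE hle k)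
  · rintro ⟨v, hv, hS⟩
    simp only [getLast?_history, Option.getD_some] at hS
    have hsub : {i | ρ t i = v} ⊆
        (((Finset.univ.map (Fin.castLEEmb hle))ᶜ : Finset (Fin r)) : Set (Fin r)) := by
      intro i hi
      simp only [Finset.coe_compl, Set.mem_compl_iff, Finset.mem_coe, Finset.mem_map,
        Finset.mem_univ, true_and, not_exists]
      rintro k rfl
      exact hS k hi
    have hcard := Set.ncard_le_ncard hsub
    rw [Set.ncard_coe_finset, Finset.card_compl, Finset.card_map, Finset.card_univ,
      Fintype.card_fin, Fintype.card_fin] at hcard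
    omega

/-- Replace the play after round `t` by the plan `π`. -/
def splice {α : Type*} (ρ : ℕ → α) (t : ℕ) (π : ℕ → α) : ℕ → α :=
  fun i => if i ≤ t then ρ i else π (i - t)

/-- A strategy sees only the past, so the spies' positions in round `t` survive a change of the
later play. The revolutionaries may therefore choose their plan after seeing those positions. -/
lemma history_splice {α : Type*} (ρ : ℕ → α) (t : ℕ) (π : ℕ → α) :
    history (splice ρ t π) t = history ρ t := by
  unfold history
  refine List.map_congr_left fun i hi => ?_
  have : i ≤ t := by simpa [Nat.lt_succ_iff] using hi
  simp [splice, this]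

lemma splice_add {α : Type*} {ρ : ℕ → α} {t : ℕ} {π : ℕ → α} (h : π 0 = ρ t) (i : ℕ) :
    splice ρ t π (t + i) = π i := by
  rcases i.eq_zero_or_pos with rfl | hi
  · simp [splice, h]
  · have : ¬ t + i ≤ t := by omega
    simp [splice, this]

lemma legalMove_splice {V : Type*} {G : SimpleGraph V} {k : ℕ} {ρ π : ℕ → Fin k → V} {t : ℕ}
    (hρ : ∀ i, LegalMove G (ρ i) (ρ (i + 1))) (hπ : ∀ i, LegalMove G (π i) (π (i + 1)))
    (h : π 0 = ρ t) (i : ℕ) : LegalMove G (splice ρ t π i) (splice ρ t π (i + 1)) := by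
  by_cases hi : i < t
  · have h1 : i + 1 ≤ t := hi
    simpa [splice, hi.le, h1] using hρ i
  · obtain ⟨j, rfl⟩ := Nat.exists_eq_add_of_le (not_lt.1 hi)
    rw [add_assoc, splice_add h, splice_add h]
    exact hπ j

/-- Greedy choice: when a token picks its vertex, fewer than `k` vertices are already taken. -/
lemma exists_injOn_of_card {V : Type*} [Fintype V] {G : SimpleGraph V} {k : ℕ}
    (hG : ∀ v, k ≤ (closedNbhd G {v}).card) {r : ℕ} (R : Fin r → V) (T : Finset (Fin r))
    (hT : T.card ≤ k) :
    ∃ f : Fin r → V, (∀ i, f i ∈ closedNbhd G {R i}) ∧ Set.InjOn f T := by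
  classical
  induction T using Finset.induction_on with
  | empty => exact ⟨R, fun i => subset_closedNbhd _ (by simp), by simp⟩
  | insert a T ha ih =>
    rw [Finset.card_insert_of_notMem ha] at hT
    obtain ⟨f, hf, hinj⟩ := ih (by omega)
    obtain ⟨y, hy, hyT⟩ : ∃ y ∈ closedNbhd G {R a}, y ∉ T.image f := by
      by_contra! hsub
      have := Finset.card_le_card (show closedNbhd G {R a} ⊆ T.image f from hsub)
      have h2 := hG (R a)
      have h3 : (T.image f).card ≤ T.card := Finset.card_image_le
      omega
    refine ⟨Function.update f a y, fun i => ?_, ?_⟩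
    · rcases eq_or_ne i a with rfl | hi
      · simpa using hy
      · simpa [hi] using hf i
    · have hne : ∀ i ∈ T, i ≠ a := fun i hi e => ha (e ▸ hi)
      have hval : ∀ i ∈ T, f i ≠ y := fun i hi e => hyT (Finset.mem_image.2 ⟨i, hi, e⟩)
      intro i hi j hj hij
      simp only [Finset.coe_insert, Set.mem_insert_iff, Finset.mem_coe] at hi hj
      rcases hi with rfl | hi <;> rcases hj with rfl | hj
      · rfl
      · rw [Function.update_self, Function.update_of_ne (hne j hj)] at hij
        exact absurd hij.symm (hval j hj)
      · rw [Function.update_self, Function.update_of_ne (hne i hi)] at hij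
        exact absurd hij (hval i hi)
      · rw [Function.update_of_ne (hne j hj), Function.update_of_ne (hne i hi)] at hij
        exact hinj hi hj hij

/-- If more tokens than spies stand on distinct vertices, then some token is alone. -/
lemma exists_unguarded {V : Type*} {r s : ℕ} (f : Fin r → V) (S : Fin s → V) (T : Finset (Fin r))
    (hT : s < T.card) (hinj : Set.InjOn f T) : ∃ i ∈ T, ∀ k, S k ≠ f i := by
  classical
  by_contra! hall
  have hsub : T.image f ⊆ Finset.univ.image S := by
    intro v hv
    obtain ⟨i, hi, rfl⟩ := Finset.mem_image.1 hv
    obtain ⟨k, hk⟩ := hall i hi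
    exact Finset.mem_image.2 ⟨k, Finset.mem_univ k, hk⟩
  have h1 := Finset.card_le_card hsub
  rw [Finset.card_image_of_injOn hinj] at h1
  have h2 : (Finset.univ.image S).card ≤ s := Finset.card_image_le.trans (by simp)
  omega

section Revolutionaries

variable {V : Type*} [Fintype V] {G : SimpleGraph V} {r s : ℕ}

/-- Against the spy strategy `τ` some legal play of the revolutionaries leads to the positions `R`
and `S` of the two teams, with all of the group `U` at the vertex `w` and no spy there. -/
def CanReach (G : SimpleGraph V) (τ : List (Fin r → V) → (Fin s → V)) (U : Finset (Fin r)) (w : V)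
    (R : Fin r → V) (S : Fin s → V) : Prop :=
  (∃ ρ : ℕ → (Fin r → V), (∀ t, LegalMove G (ρ t) (ρ (t + 1))) ∧
    ∃ t, ρ t = R ∧ τ (history ρ t) = S) ∧ (∀ i ∈ U, R i = w) ∧ ∀ k, S k ≠ w

open Classical in
/-- The revolutionaries can send an unguarded group `U`, together with any one unguarded
revolutionary `j` elsewhere, to an unguarded common vertex, while all others make one move of
their choice. -/
lemma CanReach.merge {C : ℕ} (hM : Mergeable G C) (hs : s ≤ C)
    {τ : List (Fin r → V) → (Fin s → V)}
    (hτ : ∀ ρ : ℕ → (Fin r → V), (∀ t, LegalMove G (ρ t) (ρ (t + 1))) →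
      ∀ t, LegalMove G (τ (history ρ t)) (τ (history ρ (t + 1))))
    {U : Finset (Fin r)} {u : V} {R : Fin r → V} {S : Fin s → V} (h : CanReach G τ U u R S)
    {x : V} (hx : x ≠ u) (hxS : ∀ k, S k ≠ x) (f : Fin r → V)
    (hf : ∀ i, f i ∈ closedNbhd G {R i}) :
    ∃ w R' S', CanReach G τ (U ∪ Finset.univ.filter fun i => R i = x) w R' S' ∧
      ∀ i ∉ U, R i ≠ x → R' i = f i := by
  classical
  obtain ⟨⟨ρ, hρ, t, hRt, hSt⟩, hU, hSu⟩ := h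
  obtain ⟨T, w, hwu, hwx, hwS⟩ := hM u x hx.symm (Finset.univ.image S)
    (Finset.card_image_le.trans (by simpa using hs))
    (by simpa using hSu) (by simpa using hxS)
  obtain ⟨πu, hu0, huT, hπu⟩ := exists_walk_of_mem_ball hwu
  obtain ⟨πx, hx0, hxT, hπx⟩ := exists_walk_of_mem_ball hwx
  -- At least one round passes, so the bystanders have completed their move to `f` by the end.
  have hT : T ≠ 0 := by
    rintro rfl
    exact hx (by rw [← hx0, hxT, ← huT, hu0])
  let π : ℕ → Fin r → V := fun k i =>
    if i ∈ U then πu k else if R i = x then πx k else if k = 0 then R i else f i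
  have hπ0 : π 0 = ρ t := by
    funext i
    rw [hRt]
    simp only [π]
    split_ifs with h1 h2
    · rw [hu0, hU i h1]
    · rw [hx0, h2]
    · rfl
  have hπ : ∀ k, LegalMove G (π k) (π (k + 1)) := by
    intro k i
    simp only [π, Nat.succ_ne_zero, if_false]
    split_ifs with h1 h2 h3
    · exact hπu k
    · exact hπx k
    · rcases mem_closedNbhd.1 (hf i) with h | ⟨a, ha, h⟩
      · exact .inl (by simpa using h)
      · rw [Finset.mem_singleton] at ha
        exact .inr (ha ▸ h)
    · exact .inl rfl
  have hleg := legalMove_splice hρ hπ hπ0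
  refine ⟨w, π T, τ (history (splice ρ t π) (t + T)),
    ⟨⟨splice ρ t π, hleg, t + T, splice_add hπ0 T, rfl⟩, ?_, ?_⟩, ?_⟩
  · intro i hi
    simp only [Finset.mem_union, Finset.mem_filter, Finset.mem_univ, true_and] at hi
    simp only [π]
    split_ifs with h1 h2
    · exact huT
    · exact hxT
    · tauto
  · intro k hk
    apply hwS
    rw [← hk]
    -- Each spy traces a lazy walk from `S`, hence is confined to the ball of radius `T`, which
    -- misses `w`.
    refine mem_ball_of_walk (σ := fun i => τ (history (splice ρ t π) (t + i)) k) ?_ ?_ T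
    · simp only [add_zero, history_splice, hSt]
      exact Finset.mem_image_of_mem _ (Finset.mem_univ k)
    · intro i
      exact hτ _ hleg (t + i) k
  · intro i hi hix
    simp [π, hi, hix, hT]

/-- On a graph in which tokens can meet in spite of `C` opponents, at most `C` spies lose against
sufficiently many revolutionaries. -/
theorem not_spiesWin_of_mergeable {C m : ℕ} (hM : Mergeable G C) (hV : C + 2 ≤ Fintype.card V)
    (hs : s ≤ C) (hm : 1 ≤ m) (hr : m + s ≤ r) : ¬ SpiesWin G r m s := by
  classical
  rintro ⟨τ, hτ⟩
  have hleg := fun ρ hρ => (hτ ρ hρ).1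
  have hN := hM.card_closedNbhd hV
  obtain ⟨T₀, hT₀⟩ : ∃ T : Finset (Fin r), T.card = s + 1 := by
    obtain ⟨T, -, hT⟩ := Finset.exists_subset_card_eq
      (s := (Finset.univ : Finset (Fin r))) (n := s + 1) (by simp; omega)
    exact ⟨T, hT⟩
  have key : ∀ k, 1 ≤ k → k ≤ m → ∃ U w R S, CanReach G τ U w R S ∧ k ≤ U.card := by
    intro k hk
    induction k, hk using Nat.le_induction with
    | base =>
      intro _
      obtain ⟨g⟩ : Nonempty (T₀ ↪ V) :=
        Function.Embedding.nonempty_of_card_le (by simp; omega)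
      obtain ⟨v₀⟩ : Nonempty V := Fintype.card_pos_iff.1 (by omega)
      let R : Fin r → V := fun i => if h : i ∈ T₀ then g ⟨i, h⟩ else v₀
      have hinj : Set.InjOn R T₀ := by
        intro i hi j hj hij
        rw [Finset.mem_coe] at hi hj
        simp only [R, hi, hj, dif_pos] at hij
        simpa using g.injective hij
      obtain ⟨i, -, hi⟩ := exists_unguarded R (τ (history (fun _ => R) 0)) T₀ (by omega) hinj
      exact ⟨{i}, R i, R, _, ⟨⟨fun _ => R, fun _ _ => .inl rfl, 0, rfl, rfl⟩, by simp, hi⟩, by simp⟩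
    | succ k hk ih =>
      intro hkm
      obtain ⟨U, u, R, S, hreach, hkU⟩ := ih (by omega)
      by_cases hbig : k + 1 ≤ U.card
      · exact ⟨U, u, R, S, hreach, hbig⟩
      have hUc : U.card = k := by omega
      -- A dummy destination, possibly empty of revolutionaries: this first merge only keeps the
      -- group unguarded while the outsiders in `T` spread out.
      obtain ⟨x, hx⟩ : ∃ x, x ∉ insert u (Finset.univ.image S) := by
        by_contra! hall
        have h1 := Finset.card_le_card (show Finset.univ ⊆ insert u (Finset.univ.image S) from
          fun v _ => hall v)
        have h2 : (insert u (Finset.univ.image S)).card ≤ s + 1 :=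
          (Finset.card_insert_le _ _).trans (Nat.succ_le_succ (Finset.card_image_le.trans (by simp)))
        rw [Finset.card_univ] at h1
        omega
      simp only [Finset.mem_insert, Finset.mem_image, Finset.mem_univ, true_and, not_or,
        not_exists] at hx
      obtain ⟨T, hTU, hTc⟩ := Finset.exists_subset_card_eq
        (s := (Uᶜ : Finset (Fin r))) (n := s + 1) (by rw [Finset.card_compl, Fintype.card_fin]; omega)
      obtain ⟨f, hf, hinj⟩ := exists_injOn_of_card (k := C + 1) hN R T (by omega)
      obtain ⟨w, R', S', hreach', hR'⟩ := hreach.merge hM hs hleg hx.1 hx.2 f hf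
      -- Anyone standing at `x` was carried along instead of following `f`; in that case the group
      -- has already grown.
      by_cases hex : ∃ i ∈ T, R i = x
      · obtain ⟨i, hi, hix⟩ := hex
        refine ⟨_, w, R', S', hreach', ?_⟩
        have hss : insert i U ⊆ U ∪ Finset.univ.filter fun i => R i = x := by
          intro j hj
          rcases Finset.mem_insert.1 hj with rfl | hj
          · exact Finset.mem_union_right _ (by simp [hix])
          · exact Finset.mem_union_left _ hj
        have := Finset.card_le_card hss
        rw [Finset.card_insert_of_notMem (Finset.mem_compl.1 (hTU hi))] at this
        omega
      · push Not at hex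
        have hRf : ∀ i ∈ T, R' i = f i := fun i hi =>
          hR' i (Finset.mem_compl.1 (hTU hi)) (hex i hi)
        have hinj' : Set.InjOn R' T := by
          intro i hi j hj hij
          rw [hRf i hi, hRf j hj] at hij
          exact hinj hi hj hij
        obtain ⟨i, hi, hiS⟩ := exists_unguarded R' S' T (by omega) hinj'
        have hUr : CanReach G τ U w R' S' :=
          ⟨hreach'.1, fun j hj => hreach'.2.1 j (Finset.mem_union_left _ hj), hreach'.2.2⟩
        have hiU := Finset.mem_compl.1 (hTU hi)
        by_cases hiw : R' i = w
        · refine ⟨insert i U, w, R', S', ⟨hUr.1, ?_, hUr.2.2⟩, ?_⟩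
          · intro j hj
            rcases Finset.mem_insert.1 hj with rfl | hj
            · exact hiw
            · exact hUr.2.1 j hj
          · rw [Finset.card_insert_of_notMem hiU]; omega
        -- The second merge fetches the unguarded outsider `i`; the bystanders stay put.
        · obtain ⟨w', R'', S'', hreach'', -⟩ := hUr.merge hM hs hleg hiw hiS R'
            (fun i => subset_closedNbhd _ (by simp))
          refine ⟨_, w', R'', S'', hreach'', ?_⟩
          have hss : insert i U ⊆ U ∪ Finset.univ.filter fun j => R' j = R' i := by
            intro j hj
            rcases Finset.mem_insert.1 hj with rfl | hj
            · exact Finset.mem_union_right _ (by simp)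
            · exact Finset.mem_union_left _ hj
          have := Finset.card_le_card hss
          rw [Finset.card_insert_of_notMem hiU] at this
          omega
  obtain ⟨U, w, R, S, ⟨⟨ρ, hρ, t, rfl, rfl⟩, hU, hS⟩, hmU⟩ := key m hm le_rfl
  refine (hτ ρ hρ).2 t ⟨w, hmU.trans ?_, hS⟩
  rw [← Set.ncard_coe_finset]
  exact Set.ncard_le_ncard fun i hi => hU i hi

/-- The spy number of a graph in which tokens can meet in spite of `r - m` opponents. -/
theorem spyNumber_eq_of_mergeable {C m : ℕ} (hM : Mergeable G C) (hV : C + 2 ≤ Fintype.card V)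
    (hm : 1 ≤ m) (hmr : m ≤ r) (hr : r - m ≤ C) : spyNumber G r m = r - m + 1 := by
  have : Nonempty V := Fintype.card_pos_iff.1 (by omega)
  have hwin := spiesWin_of_shadowing G hm hmr
  refine le_antisymm (Nat.sInf_le hwin) ?_
  by_contra! hlt
  -- The infimum is attained, so monotonicity of `SpiesWin` in the number of spies is not needed.
  have hmem : SpiesWin G r m (spyNumber G r m) := Nat.sInf_mem (s := {s | SpiesWin G r m s}) ⟨_, hwin⟩
  exact not_spiesWin_of_mergeable hM hV (by omega) hm (by omega) hmem

end Revolutionaries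

/-! ### Independence of edges and Chernoff bounds. -/

open MeasureTheory ProbabilityTheory SimpleGraph

section RandomGraph

variable {V : Type*}

instance instMeasurableSingletonClassSimpleGraph [Countable V] :
    MeasurableSingletonClass (SimpleGraph V) where
  measurableSet_singleton G := by
    have h : ({G} : Set (SimpleGraph V)) = edgeSet ⁻¹' {G.edgeSet} := by
      ext H; simp
    rw [h]
    exact measurable_edgeSet (measurableSet_singleton _)

/-- The value of `f` at a graph depends only on which of the pairs in `P` are edges. -/
def DetBy {α : Type*} (f : SimpleGraph V → α) (P : Finset (Sym2 V)) : Prop :=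
  ∀ G H : SimpleGraph V, (∀ e ∈ P, e ∈ G.edgeSet ↔ e ∈ H.edgeSet) → f G = f H

lemma DetBy.mono {α : Type*} {f : SimpleGraph V → α} {P Q : Finset (Sym2 V)} (h : DetBy f P)
    (hPQ : P ⊆ Q) : DetBy f Q :=
  fun G H hGH => h G H fun e he => hGH e (hPQ he)

lemma DetBy.comp {α β : Type*} {f : SimpleGraph V → α} {P : Finset (Sym2 V)} (h : DetBy f P)
    (g : α → β) : DetBy (fun G => g (f G)) P :=
  fun G H hGH => congrArg g (h G H hGH)

lemma DetBy.exists_eq_comp {α : Type*} [Nonempty α] {f : SimpleGraph V → α} {P : Finset (Sym2 V)}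
    (h : DetBy f P) :
    ∃ φ : (P → Prop) → α, f = fun G => φ fun e => (e : Sym2 V) ∈ G.edgeSet := by
  classical
  have hfac : Function.FactorsThrough f fun G (e : P) => (e : Sym2 V) ∈ G.edgeSet := by
    intro G H hGH
    exact h G H fun e he => iff_of_eq (congrFun hGH ⟨e, he⟩)
  obtain ⟨φ, hφ⟩ := (Function.factorsThrough_iff f).1 hfac
  exact ⟨φ, hφ⟩

lemma detBy_prod {ι : Type*} [DecidableEq V] {W : Finset ι} {f : ι → SimpleGraph V → ℝ}
    {P : ι → Finset (Sym2 V)} (hf : ∀ w ∈ W, DetBy (f w) (P w)) :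
    DetBy (fun G => ∏ w ∈ W, f w G) (W.biUnion P) := by
  intro G H hGH
  exact Finset.prod_congr rfl fun w hw =>
    hf w hw G H fun e he => hGH e (Finset.mem_biUnion.2 ⟨w, hw, he⟩)

open Classical in
/-- The pairs joining `w` to the vertices in `A`. -/
noncomputable def star (w : V) (A : Finset V) : Finset (Sym2 V) := A.image fun a => s(w, a)

lemma mem_star {w : V} {A : Finset V} {e : Sym2 V} : e ∈ star w A ↔ ∃ a ∈ A, s(w, a) = e := by
  simp [star]

lemma star_mono (w : V) {A B : Finset V} (h : A ⊆ B) : star w A ⊆ star w B := by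
  classical
  exact Finset.image_subset_image h

lemma disjoint_star_of_disjoint (w : V) {A B : Finset V} (h : Disjoint A B) :
    Disjoint (star w A) (star w B) := by
  rw [Finset.disjoint_left] at h ⊢
  intro e he he'
  obtain ⟨a, ha, rfl⟩ := mem_star.1 he
  obtain ⟨b, hb, hab⟩ := mem_star.1 he'
  rw [Sym2.congr_right] at hab
  exact h ha (hab ▸ hb)

lemma disjoint_star_of_ne {w z : V} {A : Finset V} (h : w ≠ z) (hz : z ∉ A) :
    Disjoint (star w A) (star z A) := by
  rw [Finset.disjoint_left]
  intro e he he'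
  obtain ⟨a, ha, rfl⟩ := mem_star.1 he
  obtain ⟨b, hb, hab⟩ := mem_star.1 he'
  rw [Sym2.eq_iff] at hab
  rcases hab with ⟨h1, -⟩ | ⟨h1, -⟩
  · exact h h1.symm
  · exact hz (h1 ▸ ha)

/-- The event that `w` has a neighbour in `A`. -/
def hits (w : V) (A : Finset V) : Set (SimpleGraph V) := {G | ∃ a ∈ A, G.Adj w a}

lemma detBy_hits (w : V) (A : Finset V) : DetBy (· ∈ hits w A) (star w A) := by
  intro G H hGH
  simp only [hits, Set.mem_ofPred_eq, eq_iff_iff]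
  refine exists_congr fun a => and_congr_right fun ha => ?_
  exact hGH s(w, a) (mem_star.2 ⟨a, ha, rfl⟩)

lemma DetBy.compl {R : Set (SimpleGraph V)} {P : Finset (Sym2 V)} (h : DetBy (· ∈ R) P) :
    DetBy (· ∈ Rᶜ) P := h.comp Not

lemma DetBy.inter [DecidableEq V] {R R' : Set (SimpleGraph V)} {P Q : Finset (Sym2 V)}
    (h : DetBy (· ∈ R) P) (h' : DetBy (· ∈ R') Q) : DetBy (· ∈ R ∩ R') (P ∪ Q) := by
  intro G H hGH
  have h1 := h.mono Finset.subset_union_left G H hGH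
  have h2 := h'.mono Finset.subset_union_right G H hGH
  simp only [Set.mem_inter_iff] at h1 h2 ⊢
  rw [h1, h2]

lemma detBy_hits_diff (w : V) {A B Z : Finset V} (hA : A ⊆ Z) (hB : B ⊆ Z) :
    DetBy (· ∈ hits w A \ hits w B) (star w Z) := by
  classical
  rw [Set.sdiff_eq]
  exact ((detBy_hits w A).inter (detBy_hits w B).compl).mono
    (Finset.union_subset (star_mono w hA) (star_mono w hB))

variable [Fintype V] (p : unitInterval)

/-- The random graph is the image of a product measure on pairs. Forming the graph discards diagonal
pairs, which still acts on each coordinate separately and so preserves independence. -/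
lemma iIndepFun_mem_edgeSet :
    iIndepFun (fun (e : Sym2 V) (G : SimpleGraph V) => e ∈ G.edgeSet) (binomialRandom V p) := by
  let P : Sym2 V → Measure Prop := fun e =>
    unitInterval.toNNReal p • Measure.dirac (e ∈ (Sym2.diagSetᶜ : Set (Sym2 V))) +
      unitInterval.toNNReal (unitInterval.symm p) • Measure.dirac False
  have hP : ∀ e, IsProbabilityMeasure (P e) := fun e => by
    infer_instance
  let T : (Sym2 V → Prop) → SimpleGraph V := fun ω => fromEdgeSet {e | ω e}
  have hset : Measurable fun (ω : Sym2 V → Prop) => {e | ω e} :=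
    MeasurableEquiv.setOfPred.measurable
  have hT : Measurable T := measurable_fromEdgeSet.comp hset
  have hmap : binomialRandom V p = (Measure.infinitePi P).map T := by
    rw [binomialRandom_eq_map, setBernoulli_eq_map, Measure.map_map measurable_fromEdgeSet hset]
    rfl
  have hind : iIndepFun (fun (e : Sym2 V) (ω : Sym2 V → Prop) => ω e ∧ ¬ e.IsDiag)
      (Measure.infinitePi P) :=
    iIndepFun_infinitePi (X := fun (e : Sym2 V) (q : Prop) => q ∧ ¬ e.IsDiag)
      fun e => measurable_from_top
  rw [iIndepFun_iff_measure_inter_preimage_eq_mul] at hind ⊢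
  intro S sets hsets
  have h := hind S hsets
  have hpre : ∀ e : Sym2 V, T ⁻¹' ((fun G : SimpleGraph V => e ∈ G.edgeSet) ⁻¹' sets e) =
      (fun ω : Sym2 V → Prop => ω e ∧ ¬ e.IsDiag) ⁻¹' sets e := by
    intro e
    ext ω
    simp [T]
  rw [hmap, Measure.map_apply hT (Set.toFinite _).measurableSet, Set.preimage_iInter₂]
  simp_rw [Measure.map_apply hT (Set.toFinite _).measurableSet, hpre]
  exact h

lemma integral_mul_of_detBy {f g : SimpleGraph V → ℝ} {P Q : Finset (Sym2 V)} (hf : DetBy f P)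
    (hg : DetBy g Q) (hPQ : Disjoint P Q) :
    ∫ G, f G * g G ∂(binomialRandom V p) =
      (∫ G, f G ∂(binomialRandom V p)) * ∫ G, g G ∂(binomialRandom V p) := by
  obtain ⟨φ, rfl⟩ := hf.exists_eq_comp
  obtain ⟨ψ, rfl⟩ := hg.exists_eq_comp
  have hind := (iIndepFun_mem_edgeSet (V := V) p).indepFun_finset P Q hPQ
    fun e => measurable_of_finite _
  exact hind.integral_fun_comp_mul_comp (measurable_of_finite _).aemeasurable
    (measurable_of_finite _).aemeasurable (measurable_of_finite φ).aestronglyMeasurable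
    (measurable_of_finite ψ).aestronglyMeasurable

lemma integral_prod_of_detBy {ι : Type*} {W : Finset ι} {f : ι → SimpleGraph V → ℝ}
    {P : ι → Finset (Sym2 V)} (hf : ∀ w ∈ W, DetBy (f w) (P w))
    (hP : (W : Set ι).PairwiseDisjoint P) :
    ∫ G, ∏ w ∈ W, f w G ∂(binomialRandom V p) = ∏ w ∈ W, ∫ G, f w G ∂(binomialRandom V p) := by
  classical
  induction W using Finset.induction_on with
  | empty => simp
  | insert a W ha ih =>
    simp only [Finset.prod_insert ha]
    rw [integral_mul_of_detBy p (hf a (Finset.mem_insert_self a W))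
      (detBy_prod fun w hw => hf w (Finset.mem_insert_of_mem hw)),
      ih (fun w hw => hf w (Finset.mem_insert_of_mem hw))
        (hP.subset (Finset.coe_subset.2 (Finset.subset_insert a W)))]
    rw [Finset.disjoint_biUnion_right]
    intro w hw
    exact hP (Finset.mem_coe.2 (Finset.mem_insert_self a W))
      (Finset.mem_coe.2 (Finset.mem_insert_of_mem hw)) fun e => ha (e ▸ hw)

lemma integral_indicator_eq (R : Set (SimpleGraph V)) (a b : ℝ) [∀ G, Decidable (G ∈ R)] :
    ∫ G, (if G ∈ R then a else b) ∂(binomialRandom V p) =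
      b + (binomialRandom V p).real R * (a - b) := by
  have h : ∀ G, (if G ∈ R then a else b) = b + R.indicator (fun _ => a - b) G := by
    intro G
    by_cases hG : G ∈ R <;> simp [hG]
  simp_rw [h]
  rw [integral_add (Integrable.of_finite) (Integrable.of_finite),
    integral_indicator_const _ (Set.toFinite R).measurableSet]
  simp

lemma real_inter_of_detBy {R R' : Set (SimpleGraph V)} {P Q : Finset (Sym2 V)}
    (hR : DetBy (· ∈ R) P) (hR' : DetBy (· ∈ R') Q) (hPQ : Disjoint P Q) :
    (binomialRandom V p).real (R ∩ R') =
      (binomialRandom V p).real R * (binomialRandom V p).real R' := by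
  classical
  have h := integral_mul_of_detBy p (f := fun G => if G ∈ R then (1 : ℝ) else 0)
    (g := fun G => if G ∈ R' then (1 : ℝ) else 0) (P := P) (Q := Q)
    (hR.comp fun q => if q then (1 : ℝ) else 0) (hR'.comp fun q => if q then (1 : ℝ) else 0) hPQ
  have h2 : ∀ G, (if G ∈ R then (1 : ℝ) else 0) * (if G ∈ R' then (1 : ℝ) else 0) =
      if G ∈ R ∩ R' then 1 else 0 := by
    intro G
    by_cases h1 : G ∈ R <;> by_cases h2 : G ∈ R' <;> simp [h1, h2]
  simp_rw [h2] at h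
  rw [integral_indicator_eq, integral_indicator_eq, integral_indicator_eq] at h
  simpa using h

section Blocks

variable {ι : Type*} {W : Finset ι} {R : ι → Set (SimpleGraph V)} {P : ι → Finset (Sym2 V)}

-- Exponential Markov inequality, using `1 + y ≤ exp y` in each factor of the moment generating
-- function. The event is scaled by `l` so that positive and negative `l` give the two tails.
open Classical in
lemma real_tail_le (hR : ∀ w ∈ W, DetBy (· ∈ R w) (P w)) (hP : (W : Set ι).PairwiseDisjoint P)
    (l t : ℝ) :
    (binomialRandom V p).real {G | l * t ≤ l * (W.filter fun w => G ∈ R w).card} ≤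
      Real.exp ((Real.exp l - 1) * (∑ w ∈ W, (binomialRandom V p).real (R w)) - l * t) := by
  have hprod : ∀ G, Real.exp (l * (W.filter fun w => G ∈ R w).card) =
      ∏ w ∈ W, if G ∈ R w then Real.exp l else 1 := by
    intro G
    rw [Finset.prod_ite, Finset.prod_const, Finset.prod_const_one, mul_one, mul_comm, Real.exp_nat_mul]
  have hE : ∫ G, Real.exp (l * (W.filter fun w => G ∈ R w).card) ∂(binomialRandom V p) ≤
      Real.exp ((Real.exp l - 1) * ∑ w ∈ W, (binomialRandom V p).real (R w)) := by
    simp_rw [hprod]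
    rw [integral_prod_of_detBy p
      (fun w hw => (hR w hw).comp fun q : Prop => if q then Real.exp l else 1) hP,
      Finset.mul_sum, Real.exp_sum]
    refine Finset.prod_le_prod (fun w _ => integral_nonneg fun G => ?_) fun w _ => ?_
    · dsimp only
      split_ifs <;> positivity
    · rw [integral_indicator_eq]
      linarith [Real.add_one_le_exp ((Real.exp l - 1) * (binomialRandom V p).real (R w))]
  have hmarkov := mul_meas_ge_le_integral_of_nonneg (μ := binomialRandom V p)
    (f := fun G => Real.exp (l * (W.filter fun w => G ∈ R w).card))
    (.of_forall fun G => (Real.exp_pos _).le) Integrable.of_finite (Real.exp (l * t))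
  simp only [Real.exp_le_exp] at hmarkov
  rw [Real.exp_sub, le_div_iff₀ (Real.exp_pos _), mul_comm]
  exact hmarkov.trans hE

/-- Lower tail of the number of independent events. -/
lemma real_lower_tail_le (hR : ∀ w ∈ W, DetBy (· ∈ R w) (P w))
    (hP : (W : Set ι).PairwiseDisjoint P) {l t M : ℝ} (hl : 0 ≤ l)
    (hM : M ≤ ∑ w ∈ W, (binomialRandom V p).real (R w)) :
    (binomialRandom V p).real {G | ({w | w ∈ W ∧ G ∈ R w}.ncard : ℝ) ≤ t} ≤
      Real.exp (l * t - (1 - Real.exp (-l)) * M) := by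
  classical
  have h := real_tail_le p hR hP (-l) t
  refine (measureReal_mono ?_).trans (h.trans (Real.exp_le_exp.2 ?_))
  · intro G hG
    simp only [Set.mem_ofPred_eq] at hG ⊢
    rw [← Finset.coe_filter, Set.ncard_coe_finset] at hG
    nlinarith
  · have : Real.exp (-l) ≤ 1 := Real.exp_le_one_iff.2 (by linarith)
    nlinarith

/-- Upper tail of the number of independent events. -/
lemma real_upper_tail_le (hR : ∀ w ∈ W, DetBy (· ∈ R w) (P w))
    (hP : (W : Set ι).PairwiseDisjoint P) {l t M : ℝ} (hl : 0 ≤ l)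
    (hM : ∑ w ∈ W, (binomialRandom V p).real (R w) ≤ M) :
    (binomialRandom V p).real {G | t ≤ ({w | w ∈ W ∧ G ∈ R w}.ncard : ℝ)} ≤
      Real.exp ((Real.exp l - 1) * M - l * t) := by
  classical
  have h := real_tail_le p hR hP l t
  refine (measureReal_mono ?_).trans (h.trans (Real.exp_le_exp.2 ?_))
  · intro G hG
    simp only [Set.mem_ofPred_eq] at hG ⊢
    rw [← Finset.coe_filter, Set.ncard_coe_finset] at hG
    nlinarith
  · have : 1 ≤ Real.exp l := Real.one_le_exp hl
    nlinarith

/-- The probability that none of a family of independent events occurs. -/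
lemma real_forall_notMem_le (hR : ∀ w ∈ W, DetBy (· ∈ R w) (P w))
    (hP : (W : Set ι).PairwiseDisjoint P) {q : ℝ}
    (hq : ∀ w ∈ W, q ≤ (binomialRandom V p).real (R w)) :
    (binomialRandom V p).real {G | ∀ w ∈ W, G ∉ R w} ≤ Real.exp (-(q * W.card)) := by
  classical
  have h := integral_prod_of_detBy p
    (fun w hw => (hR w hw).comp fun q : Prop => if q then (0 : ℝ) else 1) hP
  have h2 : ∀ G : SimpleGraph V, (∏ w ∈ W, if G ∈ R w then (0 : ℝ) else 1) =
      if G ∈ {G | ∀ w ∈ W, G ∉ R w} then 1 else 0 := by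
    intro G
    by_cases hG : ∀ w ∈ W, G ∉ R w
    · rw [if_pos (show G ∈ {G | ∀ w ∈ W, G ∉ R w} from hG)]
      exact Finset.prod_eq_one fun w hw => if_neg (hG w hw)
    · rw [if_neg (show G ∉ {G | ∀ w ∈ W, G ∉ R w} from hG)]
      push Not at hG
      obtain ⟨w, hw, hGw⟩ := hG
      exact Finset.prod_eq_zero hw (if_pos hGw)
  simp_rw [h2, integral_indicator_eq] at h
  have h3 : (binomialRandom V p).real {G | ∀ w ∈ W, G ∉ R w} =
      ∏ w ∈ W, (1 - (binomialRandom V p).real (R w)) := by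
    simpa [sub_eq_add_neg] using h
  rw [h3, show -(q * (W.card : ℝ)) = ∑ _w ∈ W, (-q) by simp [mul_comm], Real.exp_sum]
  refine Finset.prod_le_prod (fun w _ => ?_) fun w hw => ?_
  · have := measureReal_le_one (μ := binomialRandom V p) (s := R w)
    linarith
  · linarith [Real.add_one_le_exp (-q), hq w hw]

end Blocks

lemma real_mem_edgeSet {e : Sym2 V} (he : ¬ e.IsDiag) :
    (binomialRandom V p).real {G | e ∈ G.edgeSet} = p := by
  have hset : Measurable fun (ω : Sym2 V → Prop) => {e | ω e} :=
    MeasurableEquiv.setOfPred.measurable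
  rw [binomialRandom_eq_map, setBernoulli_eq_map, Measure.map_map measurable_fromEdgeSet hset,
    measureReal_def, Measure.map_apply (measurable_fromEdgeSet.comp hset)
      (Set.toFinite _).measurableSet]
  have hpre : (fromEdgeSet ∘ fun (ω : Sym2 V → Prop) => {e | ω e}) ⁻¹' {G | e ∈ G.edgeSet} =
      cylinder ({e} : Finset (Sym2 V)) ({fun _ => True} : Set (({e} : Finset (Sym2 V)) → Prop)) := by
    ext ω
    simp [he, funext_iff]
  rw [hpre, Measure.infinitePi_cylinder _ (measurableSet_singleton _), Measure.pi_singleton]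
  simp [he]

lemma real_compl_hits {w : V} {A : Finset V} (hw : w ∉ A) :
    (binomialRandom V p).real (hits w A)ᶜ = (1 - p : ℝ) ^ A.card := by
  classical
  have hfac : ∀ G : SimpleGraph V, (if G ∈ (hits w A)ᶜ then (1 : ℝ) else 0) =
      ∏ a ∈ A, if G ∈ hits w {a} then 0 else 1 := by
    intro G
    by_cases hG : G ∈ hits w A
    · rw [if_neg (show G ∉ (hits w A)ᶜ from not_not.2 hG)]
      obtain ⟨a, ha, hwa⟩ := hG
      symm
      exact Finset.prod_eq_zero ha (if_pos (show G ∈ hits w {a} from ⟨a, by simp, hwa⟩))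
    · rw [if_pos (show G ∈ (hits w A)ᶜ from hG)]
      refine (Finset.prod_eq_one fun a ha => if_neg ?_).symm
      rintro ⟨b, hb, hwb⟩
      rw [Finset.mem_singleton] at hb
      exact hG ⟨a, ha, hb ▸ hwb⟩
  have h1 := integral_indicator_eq p (hits w A)ᶜ 1 0
  simp_rw [hfac] at h1
  rw [integral_prod_of_detBy p (P := fun a => star w {a})
    (fun a _ => (detBy_hits w {a}).comp fun q : Prop => if q then (0 : ℝ) else 1)] at h1
  · have h2 : ∀ a ∈ A, ∫ G, (if G ∈ hits w {a} then (0 : ℝ) else 1) ∂(binomialRandom V p) =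
        1 - p := by
      intro a ha
      rw [integral_indicator_eq]
      have : hits w {a} = {G | s(w, a) ∈ G.edgeSet} := by ext; simp [hits]
      rw [this, real_mem_edgeSet]
      · ring
      · rintro (h : w = a)
        exact hw (h ▸ ha)
    rw [Finset.prod_congr rfl h2] at h1
    simpa using h1.symm
  · intro a _ b _ hab
    exact disjoint_star_of_disjoint w (by simpa using hab)

lemma real_hits {w : V} {A : Finset V} (hw : w ∉ A) :
    (binomialRandom V p).real (hits w A) = 1 - (1 - p : ℝ) ^ A.card := by
  rw [← real_compl_hits p hw, measureReal_compl (Set.toFinite _).measurableSet]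
  simp

lemma real_hits_diff {w : V} {A B : Finset V} (hA : w ∉ A) (hB : w ∉ B) (hAB : Disjoint A B) :
    (binomialRandom V p).real (hits w A \ hits w B) =
      (1 - (1 - p : ℝ) ^ A.card) * (1 - p : ℝ) ^ B.card := by
  rw [Set.sdiff_eq, real_inter_of_detBy p (detBy_hits w A) (detBy_hits w B).compl
    (disjoint_star_of_disjoint w hAB), real_hits p hA, real_compl_hits p hB]

lemma real_hits_inter_hits_diff {w : V} {A A' B : Finset V} (hA : w ∉ A) (hA' : w ∉ A')
    (hB : w ∉ B) (hAA : Disjoint A A') (hAB : Disjoint A B) (hAB' : Disjoint A' B) :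
    (binomialRandom V p).real (hits w A ∩ (hits w A' \ hits w B)) =
      (1 - (1 - p : ℝ) ^ A.card) * ((1 - (1 - p : ℝ) ^ A'.card) * (1 - p : ℝ) ^ B.card) := by
  classical
  rw [real_inter_of_detBy p (detBy_hits w A)
    (detBy_hits_diff w (Finset.subset_union_left (s₁ := A') (s₂ := B)) Finset.subset_union_right)
    (disjoint_star_of_disjoint w (Finset.disjoint_union_right.2 ⟨hAA, hAB⟩)), real_hits p hA,
    real_hits_diff p hA' hB hAB']

end RandomGraph

/-! ### Concentration of degrees and of private neighbourhoods. -/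

section Tails

variable {V : Type*} [Fintype V] (p : unitInterval)

lemma real_degree_tail_le (v : V) {η : ℝ} (h0 : 0 ≤ η) (h1 : η ≤ 1) :
    (binomialRandom V p).real
      {G | (1 + η) * (p * Fintype.card V) ≤ ({w | G.Adj w v}.ncard : ℝ)} ≤
      Real.exp (-(η ^ 2 * (p * Fintype.card V) / 4)) := by
  classical
  have hp0 := p.2.1
  have hW : ∀ G : SimpleGraph V, {w | G.Adj w v} = {w | w ∈ Finset.univ.erase v ∧ G ∈ hits w {v}} := by
    intro G
    ext w
    simp only [Set.mem_ofPred_eq, Finset.mem_erase, Finset.mem_univ, hits, Finset.mem_singleton,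
      exists_eq_left, and_true]
    exact ⟨fun h => ⟨h.ne, h⟩, fun h => h.2⟩
  simp_rw [hW]
  refine (real_upper_tail_le p (P := fun w => star w {v}) (l := η / 2)
    (M := p * Fintype.card V)
    (fun w _ => detBy_hits w {v}) ?_ (by positivity) ?_).trans ?_
  · intro w hw z hz hwz
    exact disjoint_star_of_ne hwz (by simpa using hz)
  · calc ∑ w ∈ Finset.univ.erase v, (binomialRandom V p).real (hits w {v})
        = ∑ w ∈ Finset.univ.erase v, (p : ℝ) := Finset.sum_congr rfl fun w hw => by
          rw [real_hits p (by simpa using hw)]; simp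
      _ ≤ ∑ w : V, (p : ℝ) := Finset.sum_le_sum_of_subset_of_nonneg (Finset.subset_univ _)
          fun _ _ _ => hp0
      _ = p * Fintype.card V := by simp [mul_comm]
  · rw [Real.exp_le_exp]
    have he := Real.abs_exp_sub_one_sub_id_le (x := η / 2) (by rw [abs_le]; constructor <;> linarith)
    have he' : Real.exp (η / 2) - 1 ≤ η / 2 + (η / 2) ^ 2 := by linarith [(abs_le.1 he).2]
    have hd : 0 ≤ (p : ℝ) * Fintype.card V := by positivity
    nlinarith [mul_le_mul_of_nonneg_right he' hd]

lemma one_sub_pow_le {x : ℝ} (h0 : 0 ≤ x) (h1 : x ≤ 1) (a : ℕ) (ha : x * a ≤ 1) :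
    x * a * (1 - x * a) ≤ 1 - (1 - x) ^ a := by
  have h2 : (1 - x) ^ a ≤ Real.exp (-(x * a)) := by
    rw [show -(x * (a : ℝ)) = a * (-x) by ring, Real.exp_nat_mul]
    exact pow_le_pow_left₀ (by linarith) (by linarith [Real.add_one_le_exp (-x)]) a
  have hxa : 0 ≤ x * a := by positivity
  have he := Real.abs_exp_sub_one_sub_id_le (x := -(x * a)) (by rw [abs_neg, abs_of_nonneg hxa]; exact ha)
  nlinarith [(abs_le.1 he).2]

/-- The vertices outside `A ∪ B` with a neighbour in `A` and no neighbour in `B`. -/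
def privateNbhd (G : SimpleGraph V) (A B : Finset V) : Set V :=
  {w | (w ∉ A ∧ w ∉ B) ∧ G ∈ hits w A \ hits w B}

/-- With `t = η / 12`, smallness of `p (|A| + |B|)` costs three factors `1 - t`: for the excluded
vertices, for multiple hits of `A`, and for hits of `B`. The mean is thus at least `(1 - η / 4) pn
|A|`, and the lower tail is taken with `l = η / 4`. -/
lemma real_expansion_tail_le {A B : Finset V} (hAB : Disjoint A B) {η : ℝ} (h0 : 0 ≤ η)
    (h1 : η ≤ 1) (hd : 1 ≤ (p : ℝ) * Fintype.card V) (hsmall : (p : ℝ) * (A.card + B.card) ≤ η / 12) :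
    (binomialRandom V p).real
      {G | ((privateNbhd G A B).ncard : ℝ) ≤ (1 - η) * (p * Fintype.card V) * A.card} ≤
      Real.exp (-(η ^ 2 * (p * Fintype.card V) * A.card / 8)) := by
  classical
  have hp0 := p.2.1
  have hp1 := p.2.2
  set n : ℝ := (Fintype.card V : ℝ) with hn
  set a : ℝ := (A.card : ℝ) with ha
  set b : ℝ := (B.card : ℝ) with hb
  set d : ℝ := p * n with hdd
  have ha0 : 0 ≤ a := by positivity
  have hb0 : 0 ≤ b := by positivity
  have hn0 : 0 ≤ n := by positivity
  have hW : ∀ G : SimpleGraph V, privateNbhd G A B =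
      {w | w ∈ (A ∪ B)ᶜ ∧ G ∈ hits w A \ hits w B} := by
    intro G
    ext w
    simp [privateNbhd]
  simp_rw [hW]
  have hda : 0 ≤ d * a := by positivity
  refine (real_lower_tail_le p (P := fun w => star w (A ∪ B)) (l := η / 4)
    (M := (1 - η / 4) * (d * a))
    (fun w _ => detBy_hits_diff w Finset.subset_union_left Finset.subset_union_right)
    ?_ (by positivity) ?_).trans ?_
  · intro w hw z hz hwz
    exact disjoint_star_of_ne hwz (by simpa using hz)
  · have hq : ∀ w ∈ (A ∪ B)ᶜ, (binomialRandom V p).real (hits w A \ hits w B) =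
        (1 - (1 - p : ℝ) ^ A.card) * (1 - p : ℝ) ^ B.card := by
      intro w hw
      simp only [Finset.mem_compl, Finset.mem_union, not_or] at hw
      exact real_hits_diff p hw.1 hw.2 hAB
    rw [Finset.sum_congr rfl hq, Finset.sum_const, nsmul_eq_mul, Finset.card_compl,
      Nat.cast_sub (Finset.card_le_univ _), Finset.card_union_of_disjoint hAB]
    push_cast
    rw [← hn, ← ha, ← hb]
    have hpa0 : 0 ≤ p * a := by positivity
    have hpb0 : 0 ≤ p * b := by positivity
    have hpa : p * a ≤ η / 12 := by nlinarith
    have hpb : p * b ≤ η / 12 := by nlinarith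
    have hab : a + b ≤ η / 12 * n := by
      have h2 : (a + b) * 1 ≤ (a + b) * d := mul_le_mul_of_nonneg_left hd (by positivity)
      have h3 : (a + b) * d = (p * (a + b)) * n := by rw [hdd]; ring
      nlinarith
    have hA := one_sub_pow_le hp0 hp1 A.card (by rw [← ha]; linarith)
    rw [← ha] at hA
    have hB : 1 - p * b ≤ (1 - p : ℝ) ^ B.card := by
      have := one_add_mul_le_pow (a := -(p : ℝ)) (by linarith) B.card
      rw [← sub_eq_add_neg] at this
      linarith
    set t := η / 12 with ht
    have ht0 : 0 ≤ t := by positivity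
    have hA' : p * a * (1 - t) ≤ 1 - (1 - p : ℝ) ^ A.card :=
      (mul_le_mul_of_nonneg_left (by linarith) hpa0).trans hA
    have hB' : 1 - t ≤ (1 - p : ℝ) ^ B.card := by linarith
    have h1t : 0 ≤ 1 - t := by rw [ht]; linarith
    have hAB' : p * a * (1 - t) * (1 - t) ≤
        (1 - (1 - p : ℝ) ^ A.card) * (1 - p : ℝ) ^ B.card :=
      mul_le_mul hA' hB' h1t ((by positivity : 0 ≤ p * a * (1 - t)).trans hA')
    have hN : n * (1 - t) ≤ n - (a + b) := by linarith
    have := mul_le_mul hN hAB' (by positivity) ((by positivity : 0 ≤ n * (1 - t)).trans hN)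
    refine le_trans ?_ this
    have h3 : (1 - η / 4) ≤ (1 - t) ^ 3 := by
      have : η / 4 = 3 * t := by rw [ht]; ring
      rw [this]
      have h4 : t ≤ 1 := by linarith
      nlinarith [mul_nonneg ht0 ht0]
    calc (1 - η / 4) * (d * a) ≤ (1 - t) ^ 3 * (d * a) := mul_le_mul_of_nonneg_right h3 hda
      _ = _ := by rw [hdd]; ring
  · rw [Real.exp_le_exp]
    have he := Real.abs_exp_sub_one_sub_id_le (x := -(η / 4)) (by rw [abs_le]; constructor <;> linarith)
    have he' : η / 4 - (η / 4) ^ 2 ≤ 1 - Real.exp (-(η / 4)) := by nlinarith [(abs_le.1 he).2]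
    have h2 : 0 ≤ (1 - η / 4) * (d * a) := mul_nonneg (by linarith) hda
    have h3 := mul_le_mul_of_nonneg_right he' h2
    have h4 : 0 ≤ η ^ 3 * (d * a) := by positivity
    nlinarith

end Tails

/-! ### Two-stage exposure of the edges. -/

section Exposure

variable {V : Type*} [Fintype V]

/-- The open ball: the vertices at distance less than `t` from `Z`. -/
noncomputable def openBall (G : SimpleGraph V) (Z : Finset V) : ℕ → Finset V
  | 0 => ∅
  | t + 1 => ball G Z t

lemma openBall_subset_ball (G : SimpleGraph V) (Z : Finset V) (t : ℕ) :
    openBall G Z t ⊆ ball G Z t := by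
  cases t with
  | zero => exact Finset.empty_subset _
  | succ t => exact ball_subset_succ Z t

open Classical in
/-- The vertices that have been reached from `T`, but not from `S`, within `t` steps of exploring
the graph from `Z`, and whose edges out of the explored part have not been exposed. -/
noncomputable def frontier (G : SimpleGraph V) (Z T S : Finset V) (t : ℕ) : Finset V :=
  (ball G T t \ ball G S t) \ openBall G Z t

open Classical in
/-- The pairs between `F \ I` and the complement of `F`. -/
noncomputable def boundary (I F : Finset V) : Finset (Sym2 V) :=
  Fᶜ.biUnion fun w => star w (F \ I)

/-- A boundary pair has one end in `F \ I` and the other outside `F`, so neither end lies in `I`.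
Exploring from inside `I` never queries it. -/
lemma closedNbhd_congr {G H : SimpleGraph V} {I F X : Finset V} (hIF : I ⊆ F) (hX : X ⊆ I)
    (h : ∀ e ∉ boundary I F, e ∈ G.edgeSet ↔ e ∈ H.edgeSet) :
    closedNbhd G X = closedNbhd H X := by
  classical
  ext v
  rw [mem_closedNbhd, mem_closedNbhd]
  refine or_congr_right (exists_congr fun a => and_congr_right fun ha => ?_)
  refine h s(a, v) fun hmem => ?_
  simp only [boundary, Finset.mem_biUnion, mem_star, Finset.mem_compl, Finset.mem_sdiff] at hmem
  obtain ⟨w, hw, b, ⟨hbF, hbI⟩, hwb⟩ := hmem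
  rw [Sym2.eq_iff] at hwb
  rcases hwb with ⟨rfl, -⟩ | ⟨-, rfl⟩
  · exact hw (hIF (hX ha))
  · exact hbI (hX ha)

lemma ball_congr {G H : SimpleGraph V} {Z T : Finset V} (hT : T ⊆ Z) {j : ℕ}
    (h : ∀ e ∉ boundary (openBall G Z j) (ball G Z j), e ∈ G.edgeSet ↔ e ∈ H.edgeSet)
    {l : ℕ} (hl : l ≤ j) : ball G T l = ball H T l := by
  induction l with
  | zero => rfl
  | succ l ih =>
    obtain ⟨i, rfl⟩ : ∃ i, j = i + 1 := ⟨j - 1, by omega⟩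
    simp only [ball]
    rw [← ih (by omega)]
    exact closedNbhd_congr (openBall_subset_ball G Z _)
      ((ball_mono hT l).trans (ball_mono_right Z (by omega : l ≤ i))) h

lemma openBall_congr {G H : SimpleGraph V} {Z : Finset V} {j : ℕ}
    (h : ∀ e ∉ boundary (openBall G Z j) (ball G Z j), e ∈ G.edgeSet ↔ e ∈ H.edgeSet) :
    openBall G Z j = openBall H Z j := by
  cases j with
  | zero => rfl
  | succ j => exact ball_congr subset_rfl h (Nat.le_succ j)

open Classical in
/-- The event that the exploration up to distance `j` from `u`, `x` and `S` leaves a good chance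
for a new vertex to join `u` and `x`, but not `S`, whereas no such vertex exists. -/
def NoMeeting (p : unitInterval) (u x : V) (S : Finset V) (j : ℕ) (c : ℝ) :
    Set (SimpleGraph V) :=
  {G | let Z := insert u (insert x S)
    let A := frontier G Z {u} S j
    let A' := frontier G Z {x} S j
    let Y := frontier G Z S ∅ j
    Disjoint A A' ∧
    c ≤ (1 - (1 - p : ℝ) ^ A.card) * ((1 - (1 - p : ℝ) ^ A'.card) * (1 - p : ℝ) ^ Y.card) *
      (ball G Z j)ᶜ.card ∧
    ∀ w ∈ (ball G Z j)ᶜ, G ∉ hits w A ∩ (hits w A' \ hits w Y)}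

lemma ball_empty (G : SimpleGraph V) (t : ℕ) : ball G ∅ t = ∅ := by
  induction t with
  | zero => rfl
  | succ t ih => simp [ball, ih, closedNbhd]

lemma disjoint_frontier (G : SimpleGraph V) (Z T S : Finset V) (j : ℕ) :
    Disjoint (frontier G Z T S j) (frontier G Z S ∅ j) := by
  classical
  rw [Finset.disjoint_left]
  intro v hv hv'
  simp only [frontier, Finset.mem_sdiff] at hv hv'
  exact hv.1.2 hv'.1.1

open Classical in
lemma frontier_subset {Z T S : Finset V} (hT : T ⊆ Z) (G : SimpleGraph V) (j : ℕ) :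
    frontier G Z T S j ⊆ ball G Z j \ openBall G Z j := by
  classical
  intro v hv
  simp only [frontier, Finset.mem_sdiff] at hv ⊢
  exact ⟨ball_mono hT j hv.1.1, hv.2⟩

lemma frontier_congr {G H : SimpleGraph V} {Z T S : Finset V} (hT : T ⊆ Z) (hS : S ⊆ Z) {j : ℕ}
    (h : ∀ e ∉ boundary (openBall G Z j) (ball G Z j), e ∈ G.edgeSet ↔ e ∈ H.edgeSet) :
    frontier G Z T S j = frontier H Z T S j := by
  unfold frontier
  rw [ball_congr hT h le_rfl, ball_congr hS h le_rfl, openBall_congr h]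

/-- Split according to the outcome `D` of the exploration. That outcome is determined by pairs off
the boundary of `D`, failure to meet by pairs in it, so the two are independent. Given `D`, the
failure probability is at most `exp (-c)`. -/
lemma real_noMeeting_le (p : unitInterval) (u x : V) (S : Finset V) (j : ℕ) (c : ℝ) :
    (binomialRandom V p).real (NoMeeting p u x S j c) ≤ Real.exp (-c) := by
  classical
  set Z := insert u (insert x S) with hZ
  have hu : {u} ⊆ Z := by simp [hZ]
  have hx : {x} ⊆ Z := by simp [hZ]
  have hS : S ⊆ Z := (Finset.subset_insert x S).trans (Finset.subset_insert u _)
  let data : SimpleGraph V → Finset V × Finset V × Finset V × Finset V × Finset V := fun G =>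
    (openBall G Z j, ball G Z j, frontier G Z {u} S j, frontier G Z {x} S j, frontier G Z S ∅ j)
  let Q := fun D => {G | data G = D}
  let Fail : Finset V × Finset V × Finset V × Finset V × Finset V → Set (SimpleGraph V) := fun D =>
    {G | ∀ w ∈ D.2.1ᶜ, G ∉ hits w D.2.2.1 ∩ (hits w D.2.2.2.1 \ hits w D.2.2.2.2)}
  have hsub : NoMeeting p u x S j c ⊆ ⋃ D ∈ (Finset.univ : Finset _),
      (Q D ∩ (Fail D ∩ NoMeeting p u x S j c)) := by
    intro G hG
    refine Set.mem_iUnion₂.2 ⟨data G, Finset.mem_univ _, rfl, hG.2.2, hG⟩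
  have hdataQ : ∀ D, DetBy (· ∈ Q D) (boundary D.1 D.2.1)ᶜ := by
    intro D
    have key : ∀ G H : SimpleGraph V, (∀ e ∈ (boundary D.1 D.2.1)ᶜ, e ∈ G.edgeSet ↔ e ∈ H.edgeSet) →
        data G = D → data H = D := by
      rintro G H hGH rfl
      have h : ∀ e ∉ boundary (openBall G Z j) (ball G Z j), e ∈ G.edgeSet ↔ e ∈ H.edgeSet :=
        fun e he => hGH e (Finset.mem_compl.2 he)
      simp only [data]
      rw [ball_congr subset_rfl h le_rfl, openBall_congr h, frontier_congr hu hS h,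
        frontier_congr hx hS h, frontier_congr hS (Finset.empty_subset Z) h]
    intro G H hGH
    exact propext ⟨key G H hGH, key H G fun e he => (hGH e he).symm⟩
  have hterm : ∀ D, (binomialRandom V p).real (Q D ∩ (Fail D ∩ NoMeeting p u x S j c)) ≤
      (binomialRandom V p).real (Q D) * Real.exp (-c) := by
    intro D
    rcases Set.eq_empty_or_nonempty (Q D ∩ (Fail D ∩ NoMeeting p u x S j c)) with he | ⟨G, hGQ, -, hGN⟩
    · rw [he, measureReal_empty]
      positivity
    obtain rfl : D = data G := Eq.symm hGQ
    set D := data G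
    obtain ⟨hdisj, hc, -⟩ := hGN
    have hR : ∀ w ∈ D.2.1ᶜ, DetBy (· ∈ hits w D.2.2.1 ∩ (hits w D.2.2.2.1 \ hits w D.2.2.2.2))
        (star w (D.2.1 \ D.1)) := by
      intro w _
      exact ((detBy_hits w _).inter (detBy_hits_diff w (Z := ball G Z j \ openBall G Z j)
        (frontier_subset hx G j) (frontier_subset hS G j))).mono
        (Finset.union_subset (star_mono w (frontier_subset hu G j)) subset_rfl)
    have hPd : ((D.2.1ᶜ : Finset V) : Set V).PairwiseDisjoint fun w => star w (D.2.1 \ D.1) := by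
      intro w _ z hz hwz
      refine disjoint_star_of_ne hwz fun hz' => ?_
      exact (Finset.mem_compl.1 (Finset.mem_coe.1 hz)) (Finset.mem_sdiff.1 hz').1
    have hFail : DetBy (· ∈ Fail D) (boundary D.1 D.2.1) := by
      intro G H hGH
      refine propext (forall₂_congr fun w hw => not_congr (iff_of_eq ?_))
      exact hR w hw G H fun e he => hGH e (Finset.mem_biUnion.2 ⟨w, hw, he⟩)
    calc (binomialRandom V p).real (Q D ∩ (Fail D ∩ NoMeeting p u x S j c))
        ≤ (binomialRandom V p).real (Q D ∩ Fail D) :=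
          measureReal_mono (Set.inter_subset_inter_right _ Set.inter_subset_left)
      _ = (binomialRandom V p).real (Q D) * (binomialRandom V p).real (Fail D) :=
          real_inter_of_detBy p (hdataQ D) hFail disjoint_compl_left
      _ ≤ _ := by
          refine mul_le_mul_of_nonneg_left ?_ measureReal_nonneg
          refine (real_forall_notMem_le p hR hPd (q := (1 - (1 - p : ℝ) ^ (frontier G Z {u} S j).card) *
            ((1 - (1 - p : ℝ) ^ (frontier G Z {x} S j).card) *
              (1 - p : ℝ) ^ (frontier G Z S ∅ j).card)) (fun w hw => ?_)).trans
            (Real.exp_le_exp.2 (neg_le_neg hc))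
          have hwF : w ∉ ball G Z j := Finset.mem_compl.1 hw
          have hout : ∀ {T S' : Finset V}, T ⊆ Z → w ∉ frontier G Z T S' j := fun hT hw' =>
            hwF (Finset.mem_sdiff.1 (frontier_subset hT G j hw')).1
          exact (real_hits_inter_hits_diff p (hout hu) (hout hx) (hout hS) hdisj
            (disjoint_frontier G Z _ S j) (disjoint_frontier G Z _ S j)).ge
  calc (binomialRandom V p).real (NoMeeting p u x S j c)
      ≤ ∑ D, (binomialRandom V p).real (Q D ∩ (Fail D ∩ NoMeeting p u x S j c)) :=
        (measureReal_mono hsub (measure_ne_top _ _)).trans (measureReal_biUnion_finset_le _ _)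
    _ ≤ ∑ D, (binomialRandom V p).real (Q D) * Real.exp (-c) := Finset.sum_le_sum fun D _ => hterm D
    _ = Real.exp (-c) := by
        rw [← Finset.sum_mul, ← measureReal_biUnion_finset]
        · have : (⋃ D ∈ (Finset.univ : Finset _), Q D) = Set.univ := by
            refine Set.eq_univ_of_forall fun G => Set.mem_iUnion₂.2 ⟨data G, Finset.mem_univ _, rfl⟩
          rw [this]; simp
        · intro D _ D' _ hDD
          refine Set.disjoint_left.2 fun G hG hG' => hDD ?_
          exact (hG : data G = D).symm.trans hG'
        · exact fun D _ => (Set.toFinite _).measurableSet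

open Classical in
/-- Outside the exceptional event, a good chance of a meeting guarantees one. -/
lemma exists_meeting {p : unitInterval} {G : SimpleGraph V} {u x : V} {S : Finset V} {j : ℕ} {c : ℝ}
    (hG : G ∉ NoMeeting p u x S j c)
    (hc : c ≤ (1 - (1 - p : ℝ) ^ (frontier G (insert u (insert x S)) {u} S j).card) *
      ((1 - (1 - p : ℝ) ^ (frontier G (insert u (insert x S)) {x} S j).card) *
        (1 - p : ℝ) ^ (frontier G (insert u (insert x S)) S ∅ j).card) *
      (ball G (insert u (insert x S)) j)ᶜ.card) :
    ∃ t w, w ∈ ball G {u} t ∧ w ∈ ball G {x} t ∧ w ∉ ball G S t := by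
  -- Intersecting frontiers already provide a meeting at time `j`; otherwise a new vertex gives one
  -- at time `j + 1`.
  by_cases hd : Disjoint (frontier G (insert u (insert x S)) {u} S j)
      (frontier G (insert u (insert x S)) {x} S j)
  · have : ∃ w ∈ (ball G (insert u (insert x S)) j)ᶜ,
        G ∈ hits w (frontier G (insert u (insert x S)) {u} S j) ∩
          (hits w (frontier G (insert u (insert x S)) {x} S j) \
            hits w (frontier G (insert u (insert x S)) S ∅ j)) := by
      by_contra! hall
      exact hG ⟨hd, hc, hall⟩
    obtain ⟨w, hw, ⟨a, ha, hwa⟩, ⟨a', ha', hwa'⟩, hY⟩ := this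
    rw [Finset.mem_compl] at hw
    simp only [frontier, Finset.mem_sdiff] at ha ha'
    refine ⟨j + 1, w, mem_closedNbhd.2 (.inr ⟨a, ha.1.1, hwa.symm⟩),
      mem_closedNbhd.2 (.inr ⟨a', ha'.1.1, hwa'.symm⟩), fun hwS => ?_⟩
    have hSZ : S ⊆ insert u (insert x S) :=
      (Finset.subset_insert x S).trans (Finset.subset_insert u _)
    rcases mem_closedNbhd.1 hwS with h | ⟨y, hy, hyw⟩
    · exact hw (ball_mono hSZ j h)
    · by_cases hyI : y ∈ openBall G (insert u (insert x S)) j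
      · apply hw
        cases j with
        | zero => simp [openBall] at hyI
        | succ j => exact mem_closedNbhd.2 (.inr ⟨y, hyI, hyw⟩)
      · exact hY ⟨y, by simp [frontier, ball_empty, hy, hyI], hyw.symm⟩
  · rw [Finset.not_disjoint_iff] at hd
    obtain ⟨w, hw, hw'⟩ := hd
    simp only [frontier, Finset.mem_sdiff] at hw hw'
    exact ⟨j, w, hw.1.1, hw'.1.1, hw.1.2⟩

end Exposure

/-! ### Growth of balls, and deterministic criteria for `Mergeable`. -/

section Growth

variable {V : Type*} [Fintype V]

/-- All degrees are less than `D`. -/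
def DegreeLT (G : SimpleGraph V) (D : ℝ) : Prop := ∀ v, ({w | G.Adj w v}.ncard : ℝ) < D

/-- Small sets of vertices have large neighbourhoods, even outside the neighbourhood of another
set of comparable size. -/
def Expands (G : SimpleGraph V) (C : ℕ) (x θ D : ℝ) : Prop :=
  ∀ A B : Finset V, A.Nonempty → Disjoint A B → B.card ≤ 2 * C * A.card →
    x * (A.card + B.card) ≤ θ → D * A.card < (privateNbhd G A B).ncard

variable {G : SimpleGraph V}

lemma DegreeLT.card_closedNbhd_le {D : ℝ} (h : DegreeLT G D) (A : Finset V) :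
    ((closedNbhd G A).card : ℝ) ≤ A.card * (1 + D) := by
  classical
  have hsub : closedNbhd G A ⊆ A ∪ A.biUnion fun a => Finset.univ.filter fun w => G.Adj w a := by
    intro v hv
    rcases mem_closedNbhd.1 hv with hv | ⟨a, ha, hav⟩
    · exact Finset.mem_union_left _ hv
    · exact Finset.mem_union_right _ (Finset.mem_biUnion.2 ⟨a, ha, by simpa using hav.symm⟩)
  have h1 : (closedNbhd G A).card ≤
      A.card + ∑ a ∈ A, (Finset.univ.filter fun w => G.Adj w a).card :=
    (Finset.card_le_card hsub).trans ((Finset.card_union_le _ _).trans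
      (Nat.add_le_add_left Finset.card_biUnion_le _))
  have h2 : ∀ a ∈ A, ((Finset.univ.filter fun w => G.Adj w a).card : ℝ) ≤ D := by
    intro a _
    have := h a
    rw [show {w | G.Adj w a} = ((Finset.univ.filter fun w => G.Adj w a : Finset V) : Set V) by
      ext; simp, Set.ncard_coe_finset] at this
    exact this.le
  have h3 := Finset.sum_le_sum h2
  rw [Finset.sum_const, nsmul_eq_mul] at h3
  have h4 : ((closedNbhd G A).card : ℝ) ≤
      A.card + ∑ a ∈ A, ((Finset.univ.filter fun w => G.Adj w a).card : ℝ) := by exact_mod_cast h1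
  linarith

lemma DegreeLT.card_ball_le {D : ℝ} (h : DegreeLT G D) (hD : 0 ≤ D) (A : Finset V) (t : ℕ) :
    ((ball G A t).card : ℝ) ≤ A.card * (1 + D) ^ t := by
  induction t with
  | zero => simp [ball]
  | succ t ih =>
    calc ((ball G A (t + 1)).card : ℝ) ≤ (ball G A t).card * (1 + D) := h.card_closedNbhd_le _
      _ ≤ A.card * (1 + D) ^ t * (1 + D) := mul_le_mul_of_nonneg_right ih (by linarith)
      _ = _ := by ring

open Classical in
lemma privateNbhd_subset {A B : Finset V} {u : V} {S : Finset V} {l : ℕ}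
    (hA : A = ball G {u} l \ ball G S l) (hB : B = ball G S l) :
    privateNbhd G A B ⊆ (ball G {u} (l + 1) \ ball G S (l + 1) : Finset V) := by
  rintro w ⟨⟨-, hwB⟩, ⟨a, ha, hwa⟩, hB'⟩
  subst hA hB
  rw [Finset.mem_coe, Finset.mem_sdiff]
  refine ⟨mem_closedNbhd.2 (.inr ⟨a, (Finset.mem_sdiff.1 ha).1, hwa.symm⟩), fun hw => ?_⟩
  rcases mem_closedNbhd.1 hw with h | ⟨y, hy, hyw⟩
  · exact hwB h
  · exact hB' ⟨y, hy, hyw.symm⟩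

open Classical in
/-- The part of the ball around a vertex that a set of opponents cannot reach in time grows fast. -/
lemma Expands.pow_le_card {C : ℕ} {x θ D D' : ℝ} (hE : Expands G C x θ D) (hG : DegreeLT G D')
    (hx : 0 ≤ x) (hD : 0 < D) (hD' : 0 ≤ D') {j : ℕ}
    (hratio : ∀ l ≤ j, (1 + D') ^ l ≤ 2 * D ^ l)
    (hsmall : ∀ l < j, x * ((C + 1) * (1 + D') ^ l) ≤ θ) {u : V} {S : Finset V} (hu : u ∉ S)
    (hS : S.card ≤ C) {l : ℕ} (hl : l ≤ j) :
    D ^ l ≤ (ball G {u} l \ ball G S l).card := by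
  induction l with
  | zero =>
    have : ball G {u} 0 \ ball G S 0 = {u} := by
      simp only [ball]
      exact Finset.sdiff_eq_self_of_disjoint (by simpa using hu)
    simp [this]
  | succ l ih =>
    have ih := ih (by omega)
    set A := ball G {u} l \ ball G S l with hA
    set B := ball G S l with hB
    have hDl : 0 < D ^ l := by positivity
    have hApos : (0 : ℝ) < A.card := hDl.trans_le ih
    have hSC : (S.card : ℝ) ≤ C := by exact_mod_cast hS
    have hP : 0 ≤ (1 + D') ^ l := by positivity
    have hBc : (B.card : ℝ) ≤ C * (1 + D') ^ l :=
      (hG.card_ball_le hD' S l).trans (mul_le_mul_of_nonneg_right hSC hP)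
    -- The ratio of upper to lower growth stays below `2`, so the opponents' ball remains comparable
    -- to `A` and expansion applies again.
    have hBA : (B.card : ℝ) ≤ 2 * C * A.card := by
      have h1 := hratio l (by omega)
      have hC : (0 : ℝ) ≤ C := by positivity
      calc (B.card : ℝ) ≤ C * (1 + D') ^ l := hBc
        _ ≤ C * (2 * D ^ l) := mul_le_mul_of_nonneg_left h1 hC
        _ ≤ C * (2 * A.card) := by gcongr
        _ = _ := by ring
    have hAc : (A.card : ℝ) ≤ (1 + D') ^ l := by
      have h1 := hG.card_ball_le hD' {u} l
      have h2 : (A.card : ℝ) ≤ (ball G {u} l).card := by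
        exact_mod_cast Finset.card_le_card Finset.sdiff_subset
      simpa using h2.trans h1
    have hlt := hE A B (Finset.card_pos.1 (by exact_mod_cast hApos))
      Finset.sdiff_disjoint (by exact_mod_cast hBA)
      ((mul_le_mul_of_nonneg_left (by linarith) hx).trans (hsmall l (by omega)))
    have hle : (privateNbhd G A B).ncard ≤ (ball G {u} (l + 1) \ ball G S (l + 1)).card := by
      rw [← Set.ncard_coe_finset]
      exact Set.ncard_le_ncard (privateNbhd_subset hA hB)
    calc D ^ (l + 1) = D * D ^ l := by ring
      _ ≤ D * A.card := mul_le_mul_of_nonneg_left ih hD.le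
      _ ≤ (privateNbhd G A B).ncard := hlt.le
      _ ≤ _ := by exact_mod_cast hle

lemma exp_neg_two_mul_le {x : ℝ} (h0 : 0 ≤ x) (h1 : x ≤ 1 / 2) : Real.exp (-(2 * x)) ≤ 1 - x := by
  have h2 : Real.exp (-(2 * x)) ≤ 1 / (1 + 2 * x) := by
    rw [Real.exp_neg, ← one_div]
    exact one_div_le_one_div_of_le (by linarith) (by linarith [Real.add_one_le_exp (2 * x)])
  refine h2.trans ?_
  rw [div_le_iff₀ (by linarith)]
  nlinarith

/-- Expansion and the absence of exceptional meeting events allow tokens to meet. -/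
lemma mergeable_of_expands {p : unitInterval} {C : ℕ} {θ D D' c : ℝ} {j : ℕ}
    (hE : Expands G C p θ D) (hG : DegreeLT G D') (hD : 4 * (C + 2) ≤ D) (hD' : 0 ≤ D')
    (hp : (p : ℝ) ≤ 1 / 2)
    (hratio : ∀ l ≤ j, (1 + D') ^ l ≤ 2 * D ^ l)
    (hsmall : ∀ l < j, (p : ℝ) * ((C + 1) * (1 + D') ^ l) ≤ θ)
    (hcard : 4 * (C + 2) * D ^ j ≤ Fintype.card V)
    (hc : c ≤ (1 - Real.exp (-(p * (D ^ j / 2)))) ^ 2 * Real.exp (-(p * (4 * C * D ^ j))) *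
      (Fintype.card V / 2))
    (hmeet : ∀ u x : V, ∀ S : Finset V, S.card ≤ C → G ∉ NoMeeting p u x S j c) :
    Mergeable G C := by
  classical
  intro u x _ S hS hu hx
  refine exists_meeting (hmeet u x S hS) (hc.trans ?_)
  set Z := insert u (insert x S) with hZ
  have hp0 : (0 : ℝ) ≤ p := p.2.1
  have hD0 : 0 < D := lt_of_lt_of_le (by positivity) hD
  have hSC : (S.card : ℝ) ≤ C := by exact_mod_cast hS
  have hZC : (Z.card : ℝ) ≤ C + 2 := by
    have h1 : Z.card ≤ S.card + 1 + 1 :=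
      (Finset.card_insert_le _ _).trans (Nat.succ_le_succ (Finset.card_insert_le _ _))
    have h2 : (Z.card : ℝ) ≤ S.card + 1 + 1 := by exact_mod_cast h1
    linarith
  have hballZ : ∀ l ≤ j, ((ball G Z l).card : ℝ) ≤ (C + 2) * (2 * D ^ l) := fun l hl =>
    (hG.card_ball_le hD' Z l).trans
      (mul_le_mul hZC (hratio l hl) (by positivity) (by positivity))
  -- The interior is smaller by a factor of about `D ≥ 4 (C + 2)`, so removing it costs at most half
  -- of the frontier.
  have hopen : ((openBall G Z j).card : ℝ) ≤ D ^ j / 2 := by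
    rcases j with _ | i
    · simp [openBall]
    · refine (hballZ i (Nat.le_succ i)).trans ?_
      have : 0 < D ^ i := by positivity
      rw [pow_succ]
      nlinarith
  have hfront : ∀ v, v ∉ S → D ^ j / 2 ≤ (frontier G Z {v} S j).card := by
    intro v hv
    have h1 := hE.pow_le_card hG hp0 hD0 hD' hratio hsmall hv hS le_rfl
    have h2 := Finset.le_card_sdiff (openBall G Z j) (ball G {v} j \ ball G S j)
    have h3 : ((ball G {v} j \ ball G S j).card : ℝ) - (openBall G Z j).card ≤
        (frontier G Z {v} S j).card := by
      rw [sub_le_iff_le_add]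
      unfold frontier
      exact_mod_cast Nat.sub_le_iff_le_add.1 h2
    linarith
  have hY : ((frontier G Z S ∅ j).card : ℝ) ≤ 2 * C * D ^ j := by
    have h1 : (frontier G Z S ∅ j).card ≤ (ball G S j).card :=
      Finset.card_le_card (Finset.sdiff_subset.trans Finset.sdiff_subset)
    have h2 : ((frontier G Z S ∅ j).card : ℝ) ≤ (ball G S j).card := by exact_mod_cast h1
    calc _ ≤ _ := h2.trans (hG.card_ball_le hD' S j)
      _ ≤ C * (2 * D ^ j) := mul_le_mul hSC (hratio j le_rfl) (by positivity) (by positivity)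
      _ = _ := by ring
  have hmiss : ∀ k : ℕ, D ^ j / 2 ≤ k →
      1 - Real.exp (-(p * (D ^ j / 2))) ≤ 1 - (1 - p : ℝ) ^ k := by
    intro k hk
    have h1 : (1 - p : ℝ) ^ k ≤ Real.exp (-(p * k)) := by
      rw [show -((p : ℝ) * (k : ℝ)) = k * (-p) by ring, Real.exp_nat_mul]
      exact pow_le_pow_left₀ (by linarith) (by linarith [Real.add_one_le_exp (-(p : ℝ))]) k
    have h2 : Real.exp (-(p * k)) ≤ Real.exp (-(p * (D ^ j / 2))) :=
      Real.exp_le_exp.2 (neg_le_neg (mul_le_mul_of_nonneg_left hk hp0))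
    linarith
  have hYp : Real.exp (-(p * (4 * C * D ^ j))) ≤ (1 - p : ℝ) ^ (frontier G Z S ∅ j).card := by
    calc Real.exp (-(p * (4 * C * D ^ j)))
        ≤ Real.exp ((frontier G Z S ∅ j).card * (-(2 * p))) := by
          rw [Real.exp_le_exp]
          nlinarith [mul_le_mul_of_nonneg_left hY hp0]
      _ = Real.exp (-(2 * p)) ^ (frontier G Z S ∅ j).card := Real.exp_nat_mul _ _
      _ ≤ _ := pow_le_pow_left₀ (Real.exp_pos _).le (exp_neg_two_mul_le hp0 hp) _
  have hF : (Fintype.card V / 2 : ℝ) ≤ (ball G Z j)ᶜ.card := by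
    rw [Finset.card_compl, Nat.cast_sub (Finset.card_le_univ _)]
    have := hballZ j le_rfl
    linarith
  have h0 : 0 ≤ 1 - Real.exp (-(p * (D ^ j / 2))) := by
    have : Real.exp (-(p * (D ^ j / 2))) ≤ 1 := Real.exp_le_one_iff.2 (by
      have : 0 ≤ p * (D ^ j / 2) := by positivity
      linarith)
    linarith
  have hA := hmiss _ (hfront u hu)
  have hA' := hmiss _ (hfront x hx)
  refine mul_le_mul ?_ hF (by positivity) ?_
  · rw [sq, mul_assoc]
    exact mul_le_mul hA (mul_le_mul hA' hYp (by positivity) (h0.trans hA')) (by positivity)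
      (h0.trans hA)
  · exact mul_nonneg (h0.trans hA) (mul_nonneg (h0.trans hA') ((Real.exp_pos _).le.trans hYp))

/-- The case of dense graphs, where two tokens meet in a single step. -/
lemma mergeable_of_forall_notMem {p : unitInterval} {C : ℕ} {c : ℝ}
    (hcard : 2 * (C + 2) ≤ Fintype.card V)
    (hc : c ≤ (p : ℝ) ^ 2 * (1 - p : ℝ) ^ C * (Fintype.card V / 2))
    (hmeet : ∀ u x : V, ∀ S : Finset V, S.card ≤ C → G ∉ NoMeeting p u x S 0 c) :
    Mergeable G C := by
  classical
  intro u x _ S hS hu hx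
  refine exists_meeting (hmeet u x S hS) (hc.trans ?_)
  have hp0 : (0 : ℝ) ≤ p := p.2.1
  have hp1 : (p : ℝ) ≤ 1 := p.2.2
  have hsing : ∀ v, v ∉ S → frontier G (insert u (insert x S)) {v} S 0 = {v} := by
    intro v hv
    simp only [frontier, ball, openBall, Finset.sdiff_empty]
    exact Finset.sdiff_eq_self_of_disjoint (by simpa using hv)
  have hY : frontier G (insert u (insert x S)) S ∅ 0 = S := by
    simp [frontier, ball, openBall]
  rw [hsing u hu, hsing x hx, hY]
  have hF : (Fintype.card V / 2 : ℝ) ≤ (ball G (insert u (insert x S)) 0)ᶜ.card := by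
    have h1 : (insert u (insert x S)).card ≤ S.card + 1 + 1 :=
      (Finset.card_insert_le _ _).trans (Nat.succ_le_succ (Finset.card_insert_le _ _))
    rw [Finset.card_compl, Nat.cast_sub (Finset.card_le_univ _)]
    simp only [ball]
    have h2 : ((insert u (insert x S)).card : ℝ) ≤ C + 2 := by
      exact_mod_cast h1.trans (by omega)
    have h3 : (2 * (C + 2) : ℝ) ≤ Fintype.card V := by exact_mod_cast hcard
    linarith
  have hpow : (1 - p : ℝ) ^ C ≤ (1 - p : ℝ) ^ S.card :=
    pow_le_pow_of_le_one (by linarith) (by linarith) hS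
  have h0 : 0 ≤ (1 - p : ℝ) ^ C := pow_nonneg (by linarith) _
  simp only [Finset.card_singleton, pow_one, sub_sub_cancel]
  refine mul_le_mul ?_ hF (by positivity) (by have := h0.trans hpow; positivity)
  rw [sq, mul_assoc]
  gcongr

end Growth

/-! ### Union bounds over vertices and sets. -/

section UnionBounds

variable {V : Type*} [Fintype V] (p : unitInterval)

lemma exp_one_div_le {n : ℝ} (hn : 1 ≤ n) : Real.exp (1 / n) ≤ 1 + 2 / n := by
  have h1 : 1 / n ≤ 1 := by rw [div_le_one (by linarith)]; exact hn
  have h0 : 0 ≤ 1 / n := by positivity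
  have he := Real.abs_exp_sub_one_sub_id_le (x := 1 / n) (by rw [abs_of_nonneg h0]; exact h1)
  have h2 : (1 / n) ^ 2 ≤ 1 / n := by nlinarith
  have h3 : 2 / n = 1 / n + 1 / n := by ring
  linarith [(abs_le.1 he).2]

/-- By the binomial theorem the sum is `(1 + n⁻²)^n ≤ exp (1 / n)`. Union bounds over sets of all
sizes then need only a factor `n⁻²` per element. -/
lemma sum_pow_card_le (hV : 1 ≤ Fintype.card V) :
    ∑ S : Finset V, (1 / (Fintype.card V : ℝ) ^ 2) ^ S.card ≤ 1 + 2 / (Fintype.card V : ℝ) := by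
  have hn : (1 : ℝ) ≤ Fintype.card V := by exact_mod_cast hV
  have h := Fintype.sum_pow_mul_eq_add_pow V (1 / (Fintype.card V : ℝ) ^ 2) 1
  simp only [one_pow, mul_one] at h
  rw [h]
  refine le_trans ?_ (exp_one_div_le hn)
  calc (1 / (Fintype.card V : ℝ) ^ 2 + 1) ^ Fintype.card V
      ≤ Real.exp (1 / (Fintype.card V : ℝ) ^ 2) ^ Fintype.card V :=
        pow_le_pow_left₀ (by positivity) (Real.add_one_le_exp _) _
    _ = Real.exp (1 / (Fintype.card V : ℝ)) := by
        rw [← Real.exp_nat_mul]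
        congr 1
        field_simp

lemma exp_neg_mul_log {n : ℝ} (hn : 0 < n) (k : ℕ) :
    Real.exp (-(k * Real.log n)) = (1 / n) ^ k := by
  rw [← mul_neg, Real.exp_nat_mul, Real.exp_neg, Real.exp_log hn, one_div]

lemma real_not_degreeLT_le (hV : 1 ≤ Fintype.card V) {η : ℝ} (h0 : 0 ≤ η) (h1 : η ≤ 1)
    (hη : 8 * Real.log (Fintype.card V) ≤ η ^ 2 * (p * Fintype.card V)) :
    (binomialRandom V p).real {G | ¬ DegreeLT G ((1 + η) * (p * Fintype.card V))} ≤
      1 / Fintype.card V := by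
  have hn : (0 : ℝ) < Fintype.card V := by exact_mod_cast hV
  have hsub : {G : SimpleGraph V | ¬ DegreeLT G ((1 + η) * (p * Fintype.card V))} ⊆
      ⋃ v ∈ (Finset.univ : Finset V),
        {G | (1 + η) * (p * Fintype.card V) ≤ ({w | G.Adj w v}.ncard : ℝ)} := by
    intro G hG
    simp only [DegreeLT, Set.mem_ofPred_eq] at hG
    push Not at hG
    obtain ⟨v, hv⟩ := hG
    exact Set.mem_iUnion₂.2 ⟨v, Finset.mem_univ v, hv⟩
  calc _ ≤ ∑ v : V, (binomialRandom V p).real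
        {G | (1 + η) * (p * Fintype.card V) ≤ ({w | G.Adj w v}.ncard : ℝ)} :=
        (measureReal_mono hsub (measure_ne_top _ _)).trans (measureReal_biUnion_finset_le _ _)
    _ ≤ ∑ v : V, (1 / (Fintype.card V : ℝ)) ^ 2 := by
        refine Finset.sum_le_sum fun v _ => (real_degree_tail_le p v h0 h1).trans ?_
        rw [← exp_neg_mul_log hn, Real.exp_le_exp]
        push_cast
        linarith
    _ = 1 / Fintype.card V := by
        rw [Finset.sum_const, nsmul_eq_mul, Finset.card_univ]
        field_simp

/-- Since `|B| ≤ 2C |A|`, the tail `exp (-η² pn |A| / 8)` pays `n⁻²` for every element of `A` and of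
`B`. Nonemptiness of `A` leaves the factor `2 / n`. -/
lemma real_not_expands_le (hV : 1 ≤ Fintype.card V) (C : ℕ) {η : ℝ} (h0 : 0 ≤ η) (h1 : η ≤ 1)
    (hd : 1 ≤ (p : ℝ) * Fintype.card V)
    (hη : 16 * (2 * C + 1) * Real.log (Fintype.card V) ≤ η ^ 2 * (p * Fintype.card V)) :
    (binomialRandom V p).real
      {G | ¬ Expands G C p (η / 12) ((1 - η) * (p * Fintype.card V))} ≤ 6 / Fintype.card V := by
  classical
  have hn : (1 : ℝ) ≤ Fintype.card V := by exact_mod_cast hV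
  set n : ℝ := (Fintype.card V : ℝ) with hnn
  have hn0 : 0 < n := by linarith
  set y : ℝ := 1 / n ^ 2 with hy
  have hy0 : 0 ≤ y := by positivity
  let good : Finset V → Finset V → Prop := fun A B => A.Nonempty ∧ Disjoint A B ∧
    B.card ≤ 2 * C * A.card ∧ (p : ℝ) * (A.card + B.card) ≤ η / 12
  let E : Finset V → Finset V → Set (SimpleGraph V) := fun A B =>
    {G | good A B ∧ ((privateNbhd G A B).ncard : ℝ) ≤ (1 - η) * (p * n) * A.card}
  have hsub : {G : SimpleGraph V | ¬ Expands G C p (η / 12) ((1 - η) * (p * n))} ⊆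
      ⋃ A ∈ (Finset.univ.erase ∅ : Finset (Finset V)), ⋃ B ∈ (Finset.univ : Finset (Finset V)),
        E A B := by
    intro G hG
    simp only [Expands, Set.mem_ofPred_eq] at hG
    push Not at hG
    obtain ⟨A, B, hA, hAB, hBA, hsm, hle⟩ := hG
    exact Set.mem_iUnion₂.2 ⟨A, by simpa using hA.ne_empty,
      Set.mem_iUnion₂.2 ⟨B, Finset.mem_univ B, ⟨hA, hAB, hBA, hsm⟩, hle⟩⟩
  have hE : ∀ A B, (binomialRandom V p).real (E A B) ≤ y ^ A.card * y ^ B.card := by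
    intro A B
    by_cases hg : good A B
    · refine (measureReal_mono (fun G hG => hG.2) (measure_ne_top _ _)).trans
        ((real_expansion_tail_le p hg.2.1 h0 h1 hd hg.2.2.2).trans ?_)
      rw [← pow_add, hy, ← one_div_pow, ← pow_mul, ← exp_neg_mul_log hn0, Real.exp_le_exp,
        neg_le_neg_iff]
      push_cast
      have hBA : (B.card : ℝ) ≤ 2 * C * A.card := by exact_mod_cast hg.2.2.1
      have hL : 0 ≤ Real.log n := Real.log_nonneg hn
      have hA0 : (0 : ℝ) ≤ A.card := by positivity
      have := mul_le_mul_of_nonneg_right hη hA0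
      have h5 := mul_le_mul_of_nonneg_right hBA hL
      nlinarith
    · have : E A B = ∅ := Set.eq_empty_of_forall_notMem fun G hG => hg hG.1
      rw [this, measureReal_empty]
      positivity
  have hs := sum_pow_card_le hV
  rw [← hnn, ← hy] at hs
  have hs' : ∑ A ∈ Finset.univ.erase (∅ : Finset V), y ^ A.card ≤ 2 / n := by
    have := Finset.add_sum_erase Finset.univ (fun A : Finset V => y ^ A.card)
      (Finset.mem_univ ∅)
    simp only [Finset.card_empty, pow_zero] at this
    linarith
  have h2n : 2 / n ≤ 2 := by
    rw [div_le_iff₀ hn0]; linarith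
  calc _ ≤ ∑ A ∈ (Finset.univ.erase ∅ : Finset (Finset V)), ∑ B : Finset V,
        (binomialRandom V p).real (E A B) :=
        (measureReal_mono hsub (measure_ne_top _ _)).trans
          ((measureReal_biUnion_finset_le _ _).trans
            (Finset.sum_le_sum fun A _ => measureReal_biUnion_finset_le _ _))
    _ ≤ ∑ A ∈ (Finset.univ.erase ∅ : Finset (Finset V)), ∑ B : Finset V,
        y ^ A.card * y ^ B.card :=
        Finset.sum_le_sum fun A _ => Finset.sum_le_sum fun B _ => hE A B
    _ = (∑ A ∈ (Finset.univ.erase ∅ : Finset (Finset V)), y ^ A.card) *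
        ∑ B : Finset V, y ^ B.card := by rw [Finset.sum_mul_sum]
    _ ≤ 2 / n * 3 := by
        refine mul_le_mul hs' (by linarith) (Finset.sum_nonneg fun B _ => by positivity)
          (by positivity)
    _ = 6 / n := by ring

/-- The exponent `2C + 4` pays `n⁻²` for each of the at most `C` elements of `S` and `n⁻⁴` for the
pair `u`, `x`. -/
lemma real_exists_noMeeting_le (hV : 1 ≤ Fintype.card V) (C j : ℕ) {c : ℝ}
    (hc : (2 * C + 4) * Real.log (Fintype.card V) ≤ c) :
    (binomialRandom V p).real
      {G | ∃ u x : V, ∃ S : Finset V, S.card ≤ C ∧ G ∈ NoMeeting p u x S j c} ≤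
      3 / Fintype.card V := by
  classical
  have hn : (1 : ℝ) ≤ Fintype.card V := by exact_mod_cast hV
  set n : ℝ := (Fintype.card V : ℝ) with hnn
  have hn0 : 0 < n := by linarith
  set y : ℝ := 1 / n ^ 2 with hy
  let E : V → V → Finset V → Set (SimpleGraph V) := fun u x S =>
    {G | S.card ≤ C ∧ G ∈ NoMeeting p u x S j c}
  have hsub : {G | ∃ u x : V, ∃ S : Finset V, S.card ≤ C ∧ G ∈ NoMeeting p u x S j c} ⊆
      ⋃ u ∈ (Finset.univ : Finset V), ⋃ x ∈ (Finset.univ : Finset V),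
        ⋃ S ∈ (Finset.univ : Finset (Finset V)), E u x S := by
    rintro G ⟨u, x, S, hS, hG⟩
    simp only [Set.mem_iUnion]
    exact ⟨u, Finset.mem_univ u, x, Finset.mem_univ x, S, Finset.mem_univ S, hS, hG⟩
  have hE : ∀ u x S, (binomialRandom V p).real (E u x S) ≤ (1 / n) ^ 4 * y ^ S.card := by
    intro u x S
    by_cases hS : S.card ≤ C
    · refine (measureReal_mono (fun G hG => hG.2) (measure_ne_top _ _)).trans
        ((real_noMeeting_le p u x S j c).trans ?_)
      rw [hy, ← one_div_pow, ← pow_mul, ← pow_add, ← exp_neg_mul_log hn0, Real.exp_le_exp,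
        neg_le_neg_iff]
      push_cast
      have hL : 0 ≤ Real.log n := Real.log_nonneg hn
      have hSC : (S.card : ℝ) ≤ C := by exact_mod_cast hS
      nlinarith [mul_le_mul_of_nonneg_right hSC hL]
    · have : E u x S = ∅ := Set.eq_empty_of_forall_notMem fun G hG => hS hG.1
      rw [this, measureReal_empty]
      positivity
  have hs := sum_pow_card_le hV
  rw [← hnn, ← hy] at hs
  have h2n : 2 / n ≤ 2 := by
    rw [div_le_iff₀ hn0]; linarith
  calc _ ≤ ∑ u : V, ∑ x : V, ∑ S : Finset V, (binomialRandom V p).real (E u x S) :=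
        (measureReal_mono hsub (measure_ne_top _ _)).trans
          ((measureReal_biUnion_finset_le _ _).trans (Finset.sum_le_sum fun u _ =>
            (measureReal_biUnion_finset_le _ _).trans (Finset.sum_le_sum fun x _ =>
              measureReal_biUnion_finset_le _ _)))
    _ ≤ ∑ u : V, ∑ x : V, ∑ S : Finset V, (1 / n) ^ 4 * y ^ S.card :=
        Finset.sum_le_sum fun u _ => Finset.sum_le_sum fun x _ => Finset.sum_le_sum fun S _ =>
          hE u x S
    _ = n * (n * ((1 / n) ^ 4 * ∑ S : Finset V, y ^ S.card)) := by
        rw [← Finset.mul_sum, Finset.sum_const, Finset.sum_const, nsmul_eq_mul, nsmul_eq_mul,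
          Finset.card_univ]
    _ ≤ n * (n * ((1 / n) ^ 4 * 3)) := by
        gcongr
        linarith
    _ = 3 / n * (1 / n) := by field_simp
    _ ≤ 3 / n := mul_le_of_le_one_right (by positivity) (by rw [div_le_one hn0]; exact hn)

/-- A quantitative version of the sparse case. -/
theorem real_not_mergeable_le_of_sparse (hV : 1 ≤ Fintype.card V) {C j : ℕ} {η : ℝ} (h0 : 0 ≤ η)
    (h1 : η ≤ 1)
    (hη : 16 * (2 * C + 1) * Real.log (Fintype.card V) ≤ η ^ 2 * (p * Fintype.card V))
    (hp : (p : ℝ) ≤ 1 / 2) {D D' : ℝ} (hDη : D = (1 - η) * (p * Fintype.card V))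
    (hDη' : D' = (1 + η) * (p * Fintype.card V)) (hD : 4 * (C + 2) ≤ D)
    (hratio : ∀ l ≤ j, (1 + D') ^ l ≤ 2 * D ^ l)
    (hsmall : ∀ l < j, (p : ℝ) * ((C + 1) * (1 + D') ^ l) ≤ η / 12)
    (hcard : 4 * (C + 2) * D ^ j ≤ Fintype.card V)
    (hc : (2 * C + 4) * Real.log (Fintype.card V) ≤
      (1 - Real.exp (-(p * (D ^ j / 2)))) ^ 2 * Real.exp (-(p * (4 * C * D ^ j))) *
      (Fintype.card V / 2)) :
    (binomialRandom V p).real {G | ¬ Mergeable G C} ≤ 10 / Fintype.card V := by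
  have hp0 : (0 : ℝ) ≤ p := p.2.1
  have hn : (1 : ℝ) ≤ Fintype.card V := by exact_mod_cast hV
  have hd0 : 0 ≤ (p : ℝ) * Fintype.card V := by positivity
  have hL : 0 ≤ Real.log (Fintype.card V) := Real.log_nonneg hn
  have hd1 : 1 ≤ (p : ℝ) * Fintype.card V := by
    have hC : (0 : ℝ) ≤ C := by positivity
    nlinarith
  have hsub : {G : SimpleGraph V | ¬ Mergeable G C} ⊆
      {G | ¬ DegreeLT G ((1 + η) * (p * Fintype.card V))} ∪
      ({G | ¬ Expands G C p (η / 12) ((1 - η) * (p * Fintype.card V))} ∪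
      {G | ∃ u x : V, ∃ S : Finset V, S.card ≤ C ∧
        G ∈ NoMeeting p u x S j ((2 * C + 4) * Real.log (Fintype.card V))}) := by
    intro G hG
    by_contra hcon
    simp only [Set.mem_union, not_or, Set.mem_ofPred_eq, not_not] at hcon
    obtain ⟨hdeg, hexp, hmeet⟩ := hcon
    push Not at hmeet
    rw [← hDη'] at hdeg
    rw [← hDη] at hexp
    exact hG (mergeable_of_expands hexp hdeg hD (hDη' ▸ by positivity) hp hratio hsmall hcard hc
      hmeet)
  have hA := real_not_degreeLT_le p hV h0 h1 (by
    have hC : (0 : ℝ) ≤ C := by positivity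
    nlinarith [mul_nonneg hC hL])
  have hB := real_not_expands_le p hV C h0 h1 hd1 hη
  have hC := real_exists_noMeeting_le p hV C j le_rfl
  have hu1 := measureReal_mono hsub (μ := binomialRandom V p) (measure_ne_top _ _)
  refine hu1.trans ((measureReal_union_le _ _).trans ?_)
  refine (add_le_add_right (measureReal_union_le _ _) _).trans ?_
  have : 10 / (Fintype.card V : ℝ) = 1 / Fintype.card V + (6 / Fintype.card V + 3 / Fintype.card V) := by
    ring
  rw [this]
  exact add_le_add hA (add_le_add hB hC)

/-- A quantitative version of the dense case. -/
theorem real_not_mergeable_le_of_dense {C : ℕ} (hV : 2 * (C + 2) ≤ Fintype.card V)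
    (hc : (2 * C + 4) * Real.log (Fintype.card V) ≤
      (p : ℝ) ^ 2 * (1 - p : ℝ) ^ C * (Fintype.card V / 2)) :
    (binomialRandom V p).real {G | ¬ Mergeable G C} ≤ 10 / Fintype.card V := by
  have hC := real_exists_noMeeting_le p (V := V) (by omega) C 0 le_rfl
  refine (measureReal_mono ?_ (measure_ne_top _ _)).trans (hC.trans ?_)
  · intro G hG
    by_contra hcon
    simp only [Set.mem_ofPred_eq] at hcon
    push Not at hcon
    exact hG (mergeable_of_forall_notMem hV hc hcon)
  · gcongr
    norm_num

end UnionBounds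

/-! ### Choice of parameters for large `n`. -/

section Asymptotics

/-- There is a radius at which balls have size about `√N`. -/
lemma exists_radius {D M : ℝ} (hD : 1 < D) (hM : D ^ 2 < M) :
    ∃ j : ℕ, 1 ≤ j ∧ M ≤ D ^ (2 * (j + 1)) ∧ D ^ (2 * j) < M := by
  classical
  have hex : ∃ j : ℕ, M ≤ D ^ (2 * (j + 1)) := by
    obtain ⟨k, hk⟩ := pow_unbounded_of_one_lt M hD
    exact ⟨k, hk.le.trans (pow_le_pow_right₀ hD.le (by omega))⟩
  have hpos : Nat.find hex ≠ 0 := by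
    intro h0
    have := Nat.find_spec hex
    rw [h0] at this
    simp only [zero_add, mul_one] at this
    linarith
  refine ⟨Nat.find hex, Nat.one_le_iff_ne_zero.2 hpos, Nat.find_spec hex, ?_⟩
  obtain ⟨i, hi⟩ := Nat.exists_eq_succ_of_ne_zero hpos
  have := Nat.find_min hex (m := i) (by omega)
  rw [hi]
  exact not_le.1 this

lemma half_le_one_sub_exp_neg {x : ℝ} (h0 : 0 ≤ x) (h1 : x ≤ 1) : x / 2 ≤ 1 - Real.exp (-x) := by
  have h2 : Real.exp (-x) ≤ 1 / (1 + x) := by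
    rw [Real.exp_neg, ← one_div]
    exact one_div_le_one_div_of_le (by linarith) (by linarith [Real.add_one_le_exp x])
  have h3 : 1 / (1 + x) ≤ 1 - x / 2 := by
    rw [div_le_iff₀ (by linarith)]
    nlinarith
  linarith

/-- The chance that a new vertex joins two growing sets, but not the balls of the opponents. -/
lemma chance_bound {C j : ℕ} {n L d D α : ℝ} (hn : 0 < n) (hL : L = Real.log n) (hL1 : 1 ≤ L)
    (hbig : 32 * (2 * C + 4) * Real.exp (8 * C) ≤ L) (hsq : 48 * (C + 2) * L ^ 2 ≤ √n)
    (h6 : L ^ 6 ≤ n) (hd : 16 * (C + 1) * d ^ 2 ≤ n * L) (hD0 : 0 < D) (hDd : D ≤ d)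
    (hdD : d ≤ 2 * D) (hj : 1 ≤ j) (hj1 : n * L ^ 2 ≤ D ^ (2 * (j + 1)))
    (hj2 : D ^ (2 * j) < n * L ^ 2) (hα : α = d / n * (D ^ j / 2)) :
    (2 * C + 4) * L ≤ (1 - Real.exp (-α)) ^ 2 * Real.exp (-(8 * C * α)) * (n / 2) := by
  have hd0 : 0 < d := hD0.trans_le hDd
  have hα0 : 0 < α := by rw [hα]; positivity
  have hC : (0 : ℝ) ≤ C := by positivity
  -- For `α ≤ 1` the chance is of order `α² n`, which the choice of `j` makes at least `L² / 4`. For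
  -- `α ≥ 1` only the loss due to the opponents matters.
  rcases le_total α 1 with h1 | h1
  · have hlow : L ^ 2 / 4 ≤ α ^ 2 * n := by
      have h2 : D / n * (D ^ j / 2) ≤ α := by rw [hα]; gcongr
      have h3 : (D / n * (D ^ j / 2)) ^ 2 * n ≤ α ^ 2 * n := by gcongr
      refine le_trans ?_ h3
      have h4 : (D / n * (D ^ j / 2)) ^ 2 * n = D ^ (2 * (j + 1)) / (4 * n) := by
        field_simp
        ring
      rw [h4, le_div_iff₀ (by positivity)]
      linarith
    have h2 : α / 2 ≤ 1 - Real.exp (-α) := half_le_one_sub_exp_neg hα0.le h1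
    have h3 : Real.exp (-(8 * C)) ≤ Real.exp (-(8 * C * α)) :=
      Real.exp_le_exp.2 (by nlinarith)
    have h4 : (α / 2) ^ 2 * Real.exp (-(8 * C)) * (n / 2) ≤
        (1 - Real.exp (-α)) ^ 2 * Real.exp (-(8 * C * α)) * (n / 2) := by gcongr
    refine le_trans ?_ h4
    have h5 : 32 * (2 * C + 4) ≤ L * Real.exp (-(8 * C)) := by
      rw [Real.exp_neg, ← div_eq_mul_inv, le_div_iff₀ (Real.exp_pos _)]
      exact hbig
    have h6 : (α / 2) ^ 2 * Real.exp (-(8 * C)) * (n / 2) =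
        (α ^ 2 * n) * Real.exp (-(8 * C)) / 8 := by ring
    rw [h6]
    have h7 : (L ^ 2 / 4) * Real.exp (-(8 * C)) ≤ (α ^ 2 * n) * Real.exp (-(8 * C)) := by gcongr
    nlinarith
  · have hsmall : 8 * C * α ≤ L / 2 := by
      -- Radius `1` is where the upper bound `hd` on the degree is needed. For `j ≥ 2`, `D^4 < n L²`
      -- forces `α ≤ 1`.
      rcases Nat.eq_or_lt_of_le hj with rfl | hj'
      · have h2 : α ≤ d ^ 2 / (2 * n) := by
          rw [hα, pow_one]
          calc d / n * (D / 2) ≤ d / n * (d / 2) := by gcongr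
            _ = _ := by ring
        have h3 : 16 * (C + 1) * α ≤ L / 2 := by
          calc 16 * (C + 1) * α ≤ 16 * (C + 1) * (d ^ 2 / (2 * n)) := by gcongr
            _ = (16 * (C + 1) * d ^ 2) / (2 * n) := by ring
            _ ≤ (n * L) / (2 * n) := by gcongr
            _ = L / 2 := by field_simp
        nlinarith
      · have hD1 : 1 ≤ D := by
          by_contra! hlt
          have h2 : D ^ (2 * (j + 1)) ≤ 1 := pow_le_one₀ hD0.le hlt.le
          have h3 : D ^ 2 ≤ 1 := pow_le_one₀ hD0.le hlt.le
          have hn1 : 1 ≤ n := (one_le_pow₀ hL1).trans h6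
          have hL2 : 1 ≤ L ^ 2 := one_le_pow₀ hL1
          have h4 : D ^ (2 * (j + 1)) < 1 := pow_lt_one₀ hD0.le hlt (by omega)
          nlinarith
        have h4 : D ^ 4 < n * L ^ 2 :=
          (pow_le_pow_right₀ hD1 (by omega : 4 ≤ 2 * j)).trans_lt hj2
        have h5 : α ≤ D * D ^ j / n := by
          rw [hα]
          calc d / n * (D ^ j / 2) ≤ 2 * D / n * (D ^ j / 2) := by gcongr
            _ = _ := by ring
        have h7 : (D * D ^ j) ^ 4 ≤ n ^ 4 := by
          calc (D * D ^ j) ^ 4 = D ^ 4 * (D ^ (2 * j)) ^ 2 := by ring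
            _ ≤ n * L ^ 2 * (n * L ^ 2) ^ 2 := by gcongr
            _ = n ^ 3 * L ^ 6 := by ring
            _ ≤ n ^ 3 * n := by gcongr
            _ = n ^ 4 := by ring
        have h8 : D * D ^ j ≤ n := le_of_pow_le_pow_left₀ (by norm_num) hn.le h7
        have h9 : α ≤ 1 := h5.trans (by rw [div_le_one hn]; exact h8)
        have h10 : 8 * C + 1 ≤ Real.exp (8 * C) := Real.add_one_le_exp _
        nlinarith
    have h2 : 1 / 2 ≤ 1 - Real.exp (-α) := by
      have := half_le_one_sub_exp_neg (x := 1) (by norm_num) le_rfl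
      have h3 : Real.exp (-α) ≤ Real.exp (-1) := Real.exp_le_exp.2 (by linarith)
      linarith
    have h3 : Real.exp (-(L / 2)) ≤ Real.exp (-(8 * C * α)) := Real.exp_le_exp.2 (by linarith)
    have h4 : (1 / 2) ^ 2 * Real.exp (-(L / 2)) * (n / 2) ≤
        (1 - Real.exp (-α)) ^ 2 * Real.exp (-(8 * C * α)) * (n / 2) := by gcongr
    refine le_trans ?_ h4
    have h5 : Real.exp (-(L / 2)) * n = √n := by
      have h6 : √n = Real.exp (L / 2) := by
        rw [hL, Real.exp_half, Real.exp_log hn]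
      have h7 : n = Real.exp L := by rw [hL, Real.exp_log hn]
      rw [h6]
      conv_lhs => rw [h7]
      rw [← Real.exp_add]
      congr 1
      ring
    have h6 : (1 / 2) ^ 2 * Real.exp (-(L / 2)) * (n / 2) = (Real.exp (-(L / 2)) * n) / 8 := by ring
    rw [h6, h5, le_div_iff₀ (by norm_num)]
    have h7 : L ≤ L ^ 2 := le_self_pow₀ hL1 (by norm_num)
    have h8 : (C + 2) * L ≤ (C + 2) * L ^ 2 := by gcongr
    nlinarith [mul_nonneg hC (by linarith : 0 ≤ L)]

lemma pow_one_add_le_two {η : ℝ} (h0 : 0 ≤ η) {j l : ℕ} (hj : 4 * η * j ≤ 1 / 2) (hl : l ≤ j) :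
    (1 + 4 * η) ^ l ≤ 2 := by
  calc (1 + 4 * η) ^ l ≤ Real.exp (4 * η) ^ l := by
        gcongr
        linarith [Real.add_one_le_exp (4 * η)]
    _ = Real.exp (l * (4 * η)) := (Real.exp_nat_mul _ _).symm
    _ ≤ Real.exp (1 / 2) := by
        rw [Real.exp_le_exp]
        have : (l : ℝ) * (4 * η) ≤ j * (4 * η) := by gcongr
        linarith
    _ ≤ 2 := by
        have h1 := Real.add_one_le_exp (-(1 / 2 : ℝ))
        rw [Real.exp_neg] at h1
        have h2 : (1 / 2 : ℝ) ≤ (Real.exp (1 / 2))⁻¹ := by linarith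
        rw [le_inv_comm₀ (by norm_num) (Real.exp_pos _)] at h2
        simpa using h2

set_option maxHeartbeats 400000 in
/-- Sparse random graphs on sufficiently many vertices. -/
lemma real_not_mergeable_le_of_bounds {n C : ℕ} (p : unitInterval) {K L : ℝ}
    (hK : K = 16 * (2 * C + 1)) (hL : L = Real.log n)
    (hLK : 32 * K ≤ L) (hbig : 32 * (2 * C + 4) * Real.exp (8 * C) ≤ L)
    (hexp : 2 * Real.exp (8 * K) ≤ L) (hsq : 48 * (C + 2) * L ^ 2 ≤ √n)
    (h6 : L ^ 6 ≤ n) (hlow : L ^ 3 ≤ p * n) (hup : 16 * (C + 1) * ((p : ℝ) * n) ^ 2 ≤ n * L) :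
    (binomialRandom (Fin n) p).real {G | ¬ Mergeable G C} ≤ 10 / n := by
  have hC : (0 : ℝ) ≤ C := by positivity
  have hK16 : 16 ≤ K := by rw [hK]; linarith
  have hL1 : 512 ≤ L := by linarith
  have hL0 : 0 < L := by linarith
  have hLn : L ≤ L ^ 6 := le_self_pow₀ (by linarith) (by norm_num)
  have hn : (0 : ℝ) < n := by linarith
  set d : ℝ := p * n with hd
  have hp : (p : ℝ) = d / n := by rw [hd]; field_simp
  -- Small enough for the error over `j` steps to stay bounded, and large enough that `η² d ≥ K² L`
  -- when `d ≥ L³`.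
  set η : ℝ := K / L with hη
  have hη0 : 0 < η := by positivity
  have hη1 : η ≤ 1 / 32 := by rw [hη, div_le_iff₀ hL0]; linarith
  have hηL : η * L = K := by rw [hη]; field_simp
  have hL2 : L ≤ L ^ 2 := le_self_pow₀ (by linarith) (by norm_num)
  have hL3 : L ≤ L ^ 3 := le_self_pow₀ (by linarith) (by norm_num)
  have hd0 : 0 < d := by linarith
  obtain ⟨D, hDdef⟩ : ∃ D, D = (1 - η) * d := ⟨_, rfl⟩
  obtain ⟨D', hD'def⟩ : ∃ D', D' = (1 + η) * d := ⟨_, rfl⟩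
  have hDd : D ≤ d := by rw [hDdef]; nlinarith
  have hdD : d ≤ 2 * D := by rw [hDdef]; nlinarith
  have hDL : L / 2 ≤ D := by linarith
  have hD0 : 0 < D := by linarith
  have hs0 : 0 < √(n : ℝ) := Real.sqrt_pos.2 hn
  have hss : √(n : ℝ) * √n = n := Real.mul_self_sqrt hn.le
  have hCL : (C + 2) * L ≤ (C + 2) * L ^ 2 := by gcongr
  have hCL0 : 0 ≤ C * L := by positivity
  have hsL : 48 * (C + 2) * L ≤ √n := by linarith
  have hLs : 96 * L ≤ √n := by linarith
  have hnL : D ^ 2 < n * L ^ 2 := by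
    have h1 : D ^ 2 ≤ d ^ 2 := by gcongr
    have h2 : d ^ 2 ≤ n * L := by nlinarith [sq_nonneg d]
    have h3 : n * L < n * L ^ 2 := by
      have : L < L ^ 2 := by nlinarith
      exact mul_lt_mul_of_pos_left this hn
    linarith
  obtain ⟨j, hj, hj1, hj2⟩ := exists_radius (by linarith) hnL
  have hDj0 : 0 < D ^ j := by positivity
  have hDj : D ^ j ≤ √n * L := by
    refine le_of_pow_le_pow_left₀ (n := 2) (by norm_num) (by positivity) ?_
    rw [mul_pow √(n : ℝ), sq √(n : ℝ), hss, ← pow_mul, mul_comm j]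
    exact hj2.le
  -- `D^j ≤ n` gives `j log D ≤ L`, while `log D ≥ 8K = 8ηL`.
  have h4ηj : 4 * η * j ≤ 1 / 2 := by
    have h1 : 8 * K ≤ Real.log D := by
      rw [Real.le_log_iff_exp_le hD0]
      linarith
    have h2 : D ^ j ≤ n := by
      refine hDj.trans ?_
      calc √n * L ≤ √n * √n := by gcongr; linarith
        _ = n := hss
    have h3 : j * Real.log D ≤ L := by
      rw [← Real.log_pow, hL]
      exact Real.log_le_log hDj0 h2
    have h4 : j * (8 * K) ≤ L := (mul_le_mul_of_nonneg_left h1 (by positivity)).trans h3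
    rw [← hηL] at h4
    have h5 : (8 * η * j) * L ≤ 1 * L := by linarith
    linarith [le_of_mul_le_mul_right h5 hL0]
  -- The summand `1` is absorbed by `η d ≥ 1`.
  have hstep : 1 + D' ≤ (1 + 4 * η) * D := by
    have h1 : 1 ≤ η * d := by
      have : η * L ≤ η * d := mul_le_mul_of_nonneg_left (hL3.trans hlow) hη0.le
      linarith
    rw [hDdef, hD'def]
    have h2 : η * (η * d) ≤ 1 / 32 * (η * d) := mul_le_mul_of_nonneg_right hη1 (by linarith)
    linarith
  have hD'0 : 0 ≤ D' := by rw [hD'def]; positivity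
  have hratio : ∀ l ≤ j, (1 + D') ^ l ≤ 2 * D ^ l := by
    intro l hl
    have h1 := pow_one_add_le_two hη0.le h4ηj hl
    calc (1 + D') ^ l ≤ ((1 + 4 * η) * D) ^ l := by gcongr
      _ = (1 + 4 * η) ^ l * D ^ l := mul_pow _ _ _
      _ ≤ 2 * D ^ l := by gcongr
  have hgoal := real_not_mergeable_le_of_sparse (V := Fin n) p (C := C) (j := j) (η := η)
    (D := D) (D' := D')
  simp only [Fintype.card_fin] at hgoal
  refine hgoal (by exact_mod_cast hn) hη0.le (by linarith) ?_ ?_ hDdef hD'def ?_ hratio ?_ ?_ ?_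
  · rw [← hL, ← hd]
    calc 16 * (2 * C + 1) * L = K * L := by rw [hK]
      _ ≤ K ^ 2 * L := by gcongr; nlinarith
      _ = η ^ 2 * L ^ 3 := by rw [← hηL]; ring
      _ ≤ η ^ 2 * d := by gcongr
  · rw [hp, div_le_iff₀ hn]
    have h2 : d ^ 2 ≤ n * L := by nlinarith [sq_nonneg d]
    have h3 : 4 * L ≤ n := by
      calc 4 * L ≤ 1 * √n := by linarith
        _ ≤ √n * √n := by gcongr; linarith
        _ = n := hss
    refine le_of_pow_le_pow_left₀ (n := 2) (by norm_num) (by positivity) ?_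
    nlinarith
  · rw [hK] at hLK
    linarith
  · intro l hl
    have h1 : D ^ (l + 1) ≤ D ^ j := pow_le_pow_right₀ (by linarith) hl
    calc (p : ℝ) * ((C + 1) * (1 + D') ^ l) ≤ 2 * D / n * ((C + 1) * (2 * D ^ l)) := by
          rw [hp]
          gcongr
          exact hratio l hl.le
      _ = 4 * (C + 1) * D ^ (l + 1) / n := by ring
      _ ≤ 4 * (C + 1) * (√n * L) / n := by
          gcongr
          exact h1.trans hDj
      _ = 4 * (C + 1) * L / √n := by
          rw [div_eq_div_iff hn.ne' hs0.ne']
          linear_combination 4 * (C + 1) * L * hss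
      _ ≤ η / 12 := by
          rw [div_le_div_iff₀ hs0 (by norm_num), hη, div_mul_eq_mul_div, le_div_iff₀ hL0]
          have h2 : √(n : ℝ) ≤ K * √n := le_mul_of_one_le_left hs0.le (by linarith)
          have h3 : 4 * (C + 1) * L * 12 * L = 48 * (C + 1) * L ^ 2 := by ring
          have h4 : 48 * (C + 1) * L ^ 2 ≤ 48 * (C + 2) * L ^ 2 := by gcongr; norm_num
          linarith
  · calc 4 * (C + 2) * D ^ j ≤ 4 * (C + 2) * (√n * L) := by gcongr
      _ = (4 * (C + 2) * L) * √n := by ring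
      _ ≤ √n * √n := by
          gcongr
          linarith
      _ = n := hss
  · rw [← hL]
    have h := chance_bound (α := p * (D ^ j / 2)) hn hL (by linarith) hbig hsq h6 hup hD0 hDd hdD hj
      hj1 hj2 (by rw [hp])
    refine h.trans (le_of_eq ?_)
    congr 3
    ring_nf

lemma eventually_real_not_mergeable_le_of_sparse (C : ℕ) (p : ℕ → unitInterval)
    (h1 : ∀ᶠ n : ℕ in atTop, Real.log (n : ℝ) ^ 3 ≤ (p n : ℝ) * (n : ℝ))
    (h2 : (fun n : ℕ => (p n : ℝ) * (n : ℝ)) =o[atTop]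
      (fun n : ℕ => Real.sqrt ((n : ℝ) * Real.log (n : ℝ)))) :
    ∀ᶠ n : ℕ in atTop,
      (binomialRandom (Fin n) (p n)).real {G | ¬ Mergeable G C} ≤ 10 / n := by
  have hC : (0 : ℝ) ≤ C := by positivity
  have hlog : Tendsto (fun n : ℕ => Real.log (n : ℝ)) atTop atTop :=
    Real.tendsto_log_atTop.comp tendsto_natCast_atTop_atTop
  have hpow : ∀ (k : ℕ) (a r : ℝ), 0 < a → 0 < r →
      ∀ᶠ n : ℕ in atTop, Real.log (n : ℝ) ^ k ≤ a * (n : ℝ) ^ r := by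
    intro k a r ha hr
    have h := (isLittleO_log_rpow_rpow_atTop (k : ℝ) hr).comp_tendsto tendsto_natCast_atTop_atTop
    filter_upwards [h.bound ha, hlog.eventually_ge_atTop 0] with n hn hn0
    simp only [Function.comp_apply, Real.rpow_natCast] at hn
    rwa [Real.norm_of_nonneg (by positivity), Real.norm_of_nonneg (by positivity)] at hn
  -- This constant `δ` satisfies `16 (C + 1) δ² ≤ 1`, as the upper bound on the degree requires.
  have hδ : (0 : ℝ) < 1 / (4 * (C + 1)) := by positivity
  filter_upwards [h1, h2.bound hδ, hlog.eventually_ge_atTop (32 * (16 * (2 * C + 1))),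
    hlog.eventually_ge_atTop (32 * (2 * C + 4) * Real.exp (8 * C)),
    hlog.eventually_ge_atTop (2 * Real.exp (8 * (16 * (2 * C + 1)))),
    hpow 2 (1 / (48 * (C + 2))) (1 / 2) (by positivity) (by norm_num),
    hpow 6 1 1 one_pos one_pos] with n hlow hup hLK hbig hexp hsq h6
  refine real_not_mergeable_le_of_bounds (p n) rfl rfl hLK hbig hexp ?_ (by simpa using h6) hlow ?_
  · rw [Real.sqrt_eq_rpow]
    calc 48 * (C + 2) * Real.log (n : ℝ) ^ 2
        ≤ 48 * (C + 2) * (1 / (48 * (C + 2)) * (n : ℝ) ^ (1 / 2 : ℝ)) := by gcongr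
      _ = _ := by field_simp
  · have hL0 : 0 ≤ Real.log (n : ℝ) := by
      refine le_trans ?_ hLK
      positivity
    have hp0 : (0 : ℝ) ≤ p n := (p n).2.1
    rw [Real.norm_of_nonneg (by positivity), Real.norm_of_nonneg (Real.sqrt_nonneg _)] at hup
    have h3 : ((p n : ℝ) * n) ^ 2 ≤ (1 / (4 * (C + 1)) * √((n : ℝ) * Real.log n)) ^ 2 := by
      gcongr
    rw [mul_pow (1 / (4 * ((C : ℝ) + 1))), Real.sq_sqrt (by positivity)] at h3
    have h4 : 16 * ((C : ℝ) + 1) * (1 / (4 * (C + 1))) ^ 2 ≤ 1 := by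
      have : 16 * ((C : ℝ) + 1) * (1 / (4 * (C + 1))) ^ 2 = 1 / (C + 1) := by
        field_simp
        norm_num
      rw [this, div_le_one (by positivity)]
      linarith
    have h5 : (0 : ℝ) ≤ n * Real.log n := by positivity
    calc 16 * ((C : ℝ) + 1) * ((p n : ℝ) * n) ^ 2
        ≤ 16 * (C + 1) * ((1 / (4 * (C + 1))) ^ 2 * (n * Real.log n)) := by gcongr
      _ = 16 * ((C : ℝ) + 1) * (1 / (4 * (C + 1))) ^ 2 * (n * Real.log n) := by ring
      _ ≤ 1 * (n * Real.log n) := by gcongr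
      _ = _ := one_mul _

lemma eventually_real_not_mergeable_le_of_dense (C : ℕ) {ε : ℝ} (hε : 0 < ε)
    (p : ℕ → unitInterval)
    (h1 : (fun n : ℕ => Real.sqrt ((n : ℝ) * Real.log (n : ℝ))) =o[atTop]
      (fun n : ℕ => (p n : ℝ) * (n : ℝ)))
    (h2 : ∀ᶠ n : ℕ in atTop, (p n : ℝ) * (n : ℝ) < (1 - ε) * (n : ℝ)) :
    ∀ᶠ n : ℕ in atTop,
      (binomialRandom (Fin n) (p n)).real {G | ¬ Mergeable G C} ≤ 10 / n := by
  -- Chosen so that `log n ≤ b p² n` and `1 - p ≥ ε` give exactly the chance required for `j = 0`.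
  set b : ℝ := ε ^ C / (2 * (2 * C + 4)) with hb
  have hb0 : 0 < b := by positivity
  filter_upwards [h1.bound (Real.sqrt_pos.2 hb0), h2, eventually_ge_atTop (2 * (C + 2)),
    eventually_ge_atTop 1] with n hlow hup hnC hn1
  have hn : (1 : ℝ) ≤ n := by exact_mod_cast hn1
  have hp0 : (0 : ℝ) ≤ p n := (p n).2.1
  have hL : 0 ≤ Real.log (n : ℝ) := Real.log_nonneg hn
  rw [Real.norm_of_nonneg (Real.sqrt_nonneg _), Real.norm_of_nonneg (by positivity)] at hlow
  have hpε : ε ≤ 1 - p n := by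
    have := lt_of_mul_lt_mul_right hup (by linarith)
    linarith
  have hgoal := real_not_mergeable_le_of_dense (V := Fin n) (p n) (C := C)
  simp only [Fintype.card_fin] at hgoal
  refine hgoal hnC ?_
  have h3 : √((n : ℝ) * Real.log n) ^ 2 ≤ (√b * (p n * n)) ^ 2 := by gcongr
  rw [mul_pow, Real.sq_sqrt (by positivity), Real.sq_sqrt hb0.le] at h3
  have h4 : Real.log (n : ℝ) ≤ b * ((p n : ℝ) ^ 2 * n) := by
    have h5 : (n : ℝ) * Real.log n ≤ n * (b * ((p n : ℝ) ^ 2 * n)) := by linarith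
    exact le_of_mul_le_mul_left h5 (by linarith)
  calc (2 * C + 4) * Real.log (n : ℝ) ≤ (2 * C + 4) * (b * ((p n : ℝ) ^ 2 * n)) := by gcongr
    _ = (p n : ℝ) ^ 2 * ε ^ C * (n / 2) := by rw [hb]; field_simp
    _ ≤ _ := by gcongr

end Asymptotics

end RevSpies

/-! ### The theorem. -/

theorem theorem1p5 (ε : ℝ) (hε : 0 < ε) (r m : ℕ → ℕ)
    (hm : ∀ᶠ n in atTop, 1 ≤ m n ∧ m n ≤ r n)
    (hrm : (fun n => (r n : ℝ) - (m n : ℝ)) =O[atTop] (fun _ => (1 : ℝ)))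
    (p : ℕ → unitInterval)
    (hp :
      ((∀ᶠ n : ℕ in atTop, Real.log (n : ℝ) ^ 3 ≤ (p n : ℝ) * (n : ℝ)) ∧
        (fun n : ℕ => (p n : ℝ) * (n : ℝ)) =o[atTop]
          (fun n : ℕ => Real.sqrt ((n : ℝ) * Real.log (n : ℝ)))) ∨
      ((fun n : ℕ => Real.sqrt ((n : ℝ) * Real.log (n : ℝ))) =o[atTop]
          (fun n : ℕ => (p n : ℝ) * (n : ℝ)) ∧
        (∀ᶠ n : ℕ in atTop, (p n : ℝ) * (n : ℝ) < (1 - ε) * (n : ℝ)))) :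
    Tendsto
      (fun n : ℕ => SimpleGraph.binomialRandom (Fin n) (p n)
        {G | (RevSpies.spyNumber G (r n) (m n) : ℤ) = (r n : ℤ) - (m n : ℤ) + 1})
      atTop (𝓝 1) := by
  obtain ⟨c, hc⟩ := hrm.bound
  -- A single number of opponents bounding `r - m` for all large `n`.
  obtain ⟨C, hC⟩ := exists_nat_ge c
  have hmerge : ∀ᶠ n : ℕ in atTop, (SimpleGraph.binomialRandom (Fin n) (p n)).real
      {G | ¬ RevSpies.Mergeable G C} ≤ 10 / n := by
    rcases hp with ⟨h1, h2⟩ | ⟨h1, h2⟩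
    · exact RevSpies.eventually_real_not_mergeable_le_of_sparse C p h1 h2
    · exact RevSpies.eventually_real_not_mergeable_le_of_dense C hε p h1 h2
  have hreal : Tendsto (fun n : ℕ => (SimpleGraph.binomialRandom (Fin n) (p n)).real
      {G | (RevSpies.spyNumber G (r n) (m n) : ℤ) = (r n : ℤ) - (m n : ℤ) + 1}) atTop (𝓝 1) := by
    have hlim : Tendsto (fun n : ℕ => 1 - 10 / (n : ℝ)) atTop (𝓝 1) := by
      simpa using tendsto_const_nhds.sub (tendsto_const_div_atTop_nhds_zero_nat (10 : ℝ))
    refine tendsto_of_tendsto_of_tendsto_of_le_of_le' hlim tendsto_const_nhds ?_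
      (.of_forall fun n => MeasureTheory.measureReal_le_one)
    filter_upwards [hmerge, hm, hc, eventually_ge_atTop (C + 2)] with n hn hmn hcn hnC
    have hrC : r n - m n ≤ C := by
      have h1 : (r n : ℝ) - m n ≤ c := by
        have := (le_abs_self _).trans (by simpa using hcn)
        exact this
      have h2 : (r n : ℝ) ≤ C + m n := by linarith
      have h3 : r n ≤ C + m n := by exact_mod_cast h2
      omega
    have hsub : {G : SimpleGraph (Fin n) | ¬ RevSpies.Mergeable G C}ᶜ ⊆
        {G | (RevSpies.spyNumber G (r n) (m n) : ℤ) = (r n : ℤ) - (m n : ℤ) + 1} := by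
      intro G hG
      have hG' : RevSpies.Mergeable G C := not_not.1 hG
      have := RevSpies.spyNumber_eq_of_mergeable hG' (by simpa using hnC) hmn.1 hmn.2 hrC
      have hle := hmn.2
      simp only [Set.mem_ofPred_eq, this]
      omega
    have hcompl := MeasureTheory.measureReal_mono
      (μ := SimpleGraph.binomialRandom (Fin n) (p n)) hsub (MeasureTheory.measure_ne_top _ _)
    rw [MeasureTheory.measureReal_compl (Set.toFinite _).measurableSet] at hcompl
    simp only [MeasureTheory.probReal_univ] at hcompl
    linarith
  have h := ENNReal.tendsto_ofReal hreal
  simpa [MeasureTheory.measureReal_def] using h
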